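/- A quantum graph is a connected metric graph $G$ consisting of finitely many (at least one) edges $e$ of finite positive length $|e|$, loops and multiple edges being allowed. Let $L(G)=\sum_e |e|$ be its total length, let $D(G)=\sup\{\operatorname{dist}(x,y): x,y\in G\}$ be its diameter, where $\operatorname{dist}$ is the length of a shortest path in $G$ and the supremum is over all points of $G$ (not just vertices), and let $$\lambda_1(G)=\inf\left\{\frac{\int_G|u'|^2\,dx}{\int_G|u|^2\,dx} : 0\neq u\in H^1(G),\ \int_G u\,dx=0\right\}$$ be the spectral gap of the Laplacian with continuity and Kirchhoff conditions at the vertices; here $H^1(G)$ consists of the functions that are in $H^1$ on every edge and continuous at the vertices. A symmetric star dumbbell is a graph consisting of an edge (the handle) of length $h>0$ between two vertices $v_1\ne v_2$ together with $m\ge 2$ pendant edges at $v_1$ and $m$ pendant edges at $v_2$, all of the same length $\ell>0$; for $m=1$ the same construction gives a path graph of length $h+2\ell$, a degenerate symmetric star dumbbell. For every quantum graph $G$ there is a symmetric star dumbbell $T$, which has to be allowed to be degenerate ($m=1$) only if $G$ is itself a path graph (that is, isometric to a compact interval), such that $$L(T)\le L(G),\qquad D(T)\le \min\{2D(G),L(G)\},\qquad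 \lambda_1(T)\le\lambda_1(G).$$ -/

import Mathlib

open MeasureTheory

universe u v

/-- A compact, finite, connected metric graph. Every edge `e` is the interval `[0, len e]`, with
`0` glued to the vertex `src e` and `len e` glued to the vertex `tgt e`. Loops and parallel edges
are allowed; the orientation of an edge is only a parametrisation. There is at least one edge. -/
structure MetricGraph where
  /-- the vertices -/
  V : Type u
  /-- the edges -/
  E : Type v
  finiteV : Finite V
  fintypeE : Fintype E
  nonemptyE : Nonempty E
  /-- the vertex at the parameter `0` -/
  src : E → V
  /-- the vertex at the parameter `len e` -/
  tgt : E → V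
  /-- the edge lengths -/
  len : E → ℝ
  len_pos : ∀ e, 0 < len e
  connected : ∀ a b : V, Relation.EqvGen (fun x y => ∃ e, src e = x ∧ tgt e = y) a b

namespace MetricGraph

attribute [instance] MetricGraph.finiteV MetricGraph.fintypeE MetricGraph.nonemptyE

/-- The total length `L(G)`. -/
noncomputable def totalLength (G : MetricGraph.{u, v}) : ℝ := ∑ e : G.E, G.len e

/-- A point of `G`, given by an edge and a position on it. A vertex is represented by every edge
end that is glued to it. -/
structure Point (G : MetricGraph.{u, v}) where
  /-- the edge -/
  edge : G.E
  /-- the position on the edge -/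
  pos : ℝ
  pos_mem : pos ∈ Set.Icc 0 (G.len edge)

/-- The point `p` represents the vertex `a`. -/
def Point.IsAt {G : MetricGraph.{u, v}} (p : G.Point) (a : G.V) : Prop :=
  (p.pos = 0 ∧ G.src p.edge = a) ∨ (p.pos = G.len p.edge ∧ G.tgt p.edge = a)

/-- `G.PathOfLength p q r`: there is a path in `G` from `p` to `q` of length `r`, that is, a finite
concatenation of segments of edges, passing from edge to edge at common vertices. -/
inductive PathOfLength (G : MetricGraph.{u, v}) : G.Point → G.Point → ℝ → Prop
  | segment (p q : G.Point) (h : p.edge = q.edge) : PathOfLength G p q |p.pos - q.pos|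
  | vertex (p q : G.Point) (a : G.V) (hp : p.IsAt a) (hq : q.IsAt a) : PathOfLength G p q 0
  | trans (p q s : G.Point) (r r' : ℝ) (h : PathOfLength G p q r) (h' : PathOfLength G q s r') :
      PathOfLength G p s (r + r')

/-- The distance of two points: the length of a shortest path between them. -/
noncomputable def dist (G : MetricGraph.{u, v}) (p q : G.Point) : ℝ :=
  sInf {r : ℝ | G.PathOfLength p q r}

/-- The diameter `D(G)`, with the supremum taken over all points and not only over vertices. -/
noncomputable def diam (G : MetricGraph.{u, v}) : ℝ :=
  sSup {d : ℝ | ∃ p q : G.Point, d = G.dist p q}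

/-- `G` is a path graph (up to vertices of degree two): as a metric space it is isometric to a
compact interval. -/
def IsPath (G : MetricGraph.{u, v}) : Prop :=
  ∃ (a : ℝ) (f : G.Point → ℝ),
    Set.range f = Set.Icc 0 a ∧ ∀ p q : G.Point, |f p - f q| = G.dist p q

/-- A function in the Sobolev space `H¹(G)`: on every edge it is (the continuous representative of)
an `H¹` function, that is, it is absolutely continuous with square integrable derivative `der`, and
it is continuous at the vertices. Only the values on `[0, len e]` matter, and `der` is determined
by `toFun` up to null sets of `[0, len e]`. -/
structure H1 (G : MetricGraph.{u, v}) where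
  /-- the function -/
  toFun : G.E → ℝ → ℝ
  /-- its (weak) derivative -/
  der : G.E → ℝ → ℝ
  der_memLp : ∀ e, MemLp (der e) 2 (volume.restrict (Set.Icc 0 (G.len e)))
  eq_integral : ∀ e, ∀ x ∈ Set.Icc 0 (G.len e), toFun e x = toFun e 0 + ∫ t in 0..x, der e t
  continuous_vertex : ∃ val : G.V → ℝ,
    ∀ e, toFun e 0 = val (G.src e) ∧ toFun e (G.len e) = val (G.tgt e)

/-- `∫_G u`. -/
noncomputable def H1.integral {G : MetricGraph.{u, v}} (u : G.H1) : ℝ :=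
  ∑ e : G.E, ∫ x in 0..G.len e, u.toFun e x

/-- `∫_G |u|²`. -/
noncomputable def H1.normSq {G : MetricGraph.{u, v}} (u : G.H1) : ℝ :=
  ∑ e : G.E, ∫ x in 0..G.len e, u.toFun e x ^ 2

/-- `∫_G |u'|²`. -/
noncomputable def H1.energy {G : MetricGraph.{u, v}} (u : G.H1) : ℝ :=
  ∑ e : G.E, ∫ x in 0..G.len e, u.der e x ^ 2

/-- The spectral gap `λ₁(G)` of the Laplacian with continuity and Kirchhoff conditions: the infimum
of the Rayleigh quotient over the nonzero functions in `H¹(G)` of mean zero. -/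
noncomputable def lambda1 (G : MetricGraph.{u, v}) : ℝ :=
  sInf {R : ℝ | ∃ u : G.H1, u.integral = 0 ∧ u.normSq ≠ 0 ∧ R = u.energy / u.normSq}

/-- The star dumbbell with handle of length `h` between the vertices `(false, none)` and
`(true, none)`, at each of which `m` further edges of length `l` are attached, with the other ends
free. -/
def starDumbbell (m : ℕ) (h l : ℝ) (hh : 0 < h) (hl : 0 < l) : MetricGraph.{0, 0} where
  V := Bool × Option (Fin m)
  E := Option (Bool × Fin m)
  finiteV := inferInstance
  fintypeE := inferInstance
  nonemptyE := inferInstance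
  src e := match e with
    | none => (false, none)
    | some (s, _) => (s, none)
  tgt e := match e with
    | none => (true, none)
    | some (s, i) => (s, some i)
  len e := match e with
    | none => h
    | some _ => l
  len_pos e := by
    cases e with
    | none => exact hh
    | some _ => exact hl
  connected := by
    have key : ∀ a : Bool × Option (Fin m), Relation.EqvGen
        (fun x y => ∃ e : Option (Bool × Fin m),
          (match e with
            | none => ((false, none) : Bool × Option (Fin m))
            | some (s, _) => (s, none)) = x ∧
          (match e with
            | none => ((true, none) : Bool × Option (Fin m))
            | some (s, i) => (s, some i)) = y) (false, none) a := by
      have h0 : ∀ s : Bool, Relation.EqvGen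
          (fun x y => ∃ e : Option (Bool × Fin m),
            (match e with
              | none => ((false, none) : Bool × Option (Fin m))
              | some (s, _) => (s, none)) = x ∧
            (match e with
              | none => ((true, none) : Bool × Option (Fin m))
              | some (s, i) => (s, some i)) = y) (false, none) (s, none) := by
        intro s
        cases s with
        | false => exact Relation.EqvGen.refl _
        | true => exact Relation.EqvGen.rel _ _ ⟨none, rfl, rfl⟩
      rintro ⟨s, _ | i⟩
      · exact h0 s
      · exact Relation.EqvGen.trans _ _ _ (h0 s)
          (Relation.EqvGen.rel _ _ ⟨some (s, i), rfl, rfl⟩)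
    intro a b
    exact Relation.EqvGen.trans _ _ _ (Relation.EqvGen.symm _ _ (key a)) (key b)

end MetricGraph

/-! Write D and L for the diameter and the total length of G. The model is an interval of length D
with a point mass (L - D)/2 at each end; its spectral gap is k², where k > 0 solves kD + 2
arctan(k(L - D)/2) = π (`exists_frequency`). The proof shows λ₁(T) ≤ k² ≤ λ₁(G).

Lower bound (`sq_le_lambda1`). Let w have mean zero, minimum a at x and maximum b at y. Keep a
shortest path from x to y, of length p ≤ D (`exists_isGeodesic`), and replace the rest of G, of
length L - p, by point masses at x and y with the same total mass and the same integral of w. As (b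
- w)(w - a) ≥ 0, this does not decrease ∫w², and discarding the rest does not increase the energy
(`rayleigh_bound`). For the interval with masses one cuts at a point z, subtracts the value there,
and applies Picone's inequality on both sides (`interval_mass_bound`). Since `arctan` is concave on
[0, ∞) and 1-Lipschitz, equal masses and p = D are the worst case.

Upper bound. If D < L, take a handle of length D and m pendant edges of total length (L - D)/2 at
each end. The model's eigenfunction, extended by constants to the pendant edges, gives λ₁(T) ≤ k²
(`starDumbbell_lambda1_le_of_arctan`). The total length is L, and the diameter is at most D + 2l,
which is below min(2D, L) once m is large. If D = L, then G is a path (`isPath_of_diam_eq`), k =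
π/L, and an interval of length L serves as T. -/

namespace MetricGraph

/-! ### Paths and the distance -/

variable {G : MetricGraph.{u, v}}

lemma PathOfLength.nonneg {p q : G.Point} {r : ℝ} (h : G.PathOfLength p q r) : 0 ≤ r := by
  induction h with
  | segment => positivity
  | vertex => exact le_rfl
  | trans _ _ _ _ _ _ _ h h' => exact add_nonneg h h'

lemma PathOfLength.symm {p q : G.Point} {r : ℝ} (h : G.PathOfLength p q r) :
    G.PathOfLength q p r := by
  induction h with
  | segment p q h => rw [abs_sub_comm]; exact .segment _ _ h.symm
  | vertex p q a hp hq => exact .vertex _ _ a hq hp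
  | trans p q s r r' _ _ h h' => rw [add_comm]; exact .trans _ _ _ _ _ h' h

lemma bddBelow_pathOfLength (p q : G.Point) : BddBelow {r : ℝ | G.PathOfLength p q r} :=
  ⟨0, fun _ h => h.nonneg⟩

lemma PathOfLength.dist_le {p q : G.Point} {r : ℝ} (h : G.PathOfLength p q r) : G.dist p q ≤ r :=
  csInf_le (bddBelow_pathOfLength p q) h

/-- The point of the edge `e` closest to the parameter `t`. -/
noncomputable def point (G : MetricGraph.{u, v}) (e : G.E) (t : ℝ) : G.Point :=
  ⟨e, Set.projIcc 0 (G.len e) (G.len_pos e).le t, (Set.projIcc 0 (G.len e) (G.len_pos e).le t).2⟩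

@[simp] lemma point_edge (e : G.E) (t : ℝ) : (G.point e t).edge = e := rfl

lemma point_pos {e : G.E} {t : ℝ} (ht : t ∈ Set.Icc 0 (G.len e)) : (G.point e t).pos = t := by
  simp [point, Set.projIcc_of_mem _ ht]

@[simp] lemma point_edge_pos (p : G.Point) : G.point p.edge p.pos = p := by
  obtain ⟨e, t, ht⟩ := p
  simp [point, Set.projIcc_of_mem _ ht]

lemma zero_mem (e : G.E) : (0 : ℝ) ∈ Set.Icc 0 (G.len e) := ⟨le_rfl, (G.len_pos e).le⟩

lemma len_mem (e : G.E) : G.len e ∈ Set.Icc 0 (G.len e) := ⟨(G.len_pos e).le, le_rfl⟩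

lemma isAt_src (e : G.E) : (G.point e 0).IsAt (G.src e) := .inl ⟨point_pos (zero_mem e), rfl⟩

lemma isAt_tgt (e : G.E) : (G.point e (G.len e)).IsAt (G.tgt e) :=
  .inr ⟨point_pos (len_mem e), rfl⟩

lemma exists_path (p q : G.Point) : ∃ r, G.PathOfLength p q r := by
  -- The second conjunct is carried along because transitivity needs a point at the intermediate
  -- vertex, and vertices have points only through incident edge ends.
  have key : ∀ a b : G.V, Relation.EqvGen (fun x y => ∃ e, G.src e = x ∧ G.tgt e = y) a b →
      (∀ p q : G.Point, p.IsAt a → q.IsAt b → ∃ r, G.PathOfLength p q r) ∧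
      ((∃ p : G.Point, p.IsAt a) ↔ ∃ p : G.Point, p.IsAt b) := by
    intro a b h
    induction h with
    | rel a b h =>
      obtain ⟨e, rfl, rfl⟩ := h
      exact ⟨fun p q hp hq => ⟨_, .trans _ _ _ _ _ (.vertex _ _ _ hp (isAt_src e))
        (.trans _ _ _ _ _ (.segment _ (G.point e (G.len e)) rfl)
          (.vertex _ _ _ (isAt_tgt e) hq))⟩,
        fun _ => ⟨_, isAt_tgt e⟩, fun _ => ⟨_, isAt_src e⟩⟩
    | refl a => exact ⟨fun p q hp hq => ⟨_, .vertex _ _ _ hp hq⟩, Iff.rfl⟩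
    | symm a b _ h =>
      exact ⟨fun p q hp hq => (h.1 q p hq hp).imp fun _ h => h.symm, h.2.symm⟩
    | trans a b c _ _ h h' =>
      refine ⟨fun p q hp hq => ?_, h.2.trans h'.2⟩
      obtain ⟨s, hs⟩ := h.2.1 ⟨p, hp⟩
      obtain ⟨r, hr⟩ := h.1 _ _ hp hs
      obtain ⟨r', hr'⟩ := h'.1 _ _ hs hq
      exact ⟨_, .trans _ _ _ _ _ hr hr'⟩
  obtain ⟨r, hr⟩ := (key _ _ (G.connected (G.src p.edge) (G.src q.edge))).1 _ _
    (isAt_src _) (isAt_src _)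
  exact ⟨_, .trans _ _ _ _ _ (.segment p (G.point p.edge 0) rfl)
    (.trans _ _ _ _ _ hr (.segment _ q rfl))⟩

lemma dist_nonneg (p q : G.Point) : 0 ≤ G.dist p q :=
  le_csInf (exists_path p q) fun _ h => h.nonneg

lemma dist_comm (p q : G.Point) : G.dist p q = G.dist q p := by
  unfold dist
  congr 1
  ext r
  exact ⟨.symm, .symm⟩

lemma dist_triangle (p q s : G.Point) : G.dist p s ≤ G.dist p q + G.dist q s := by
  refine le_of_forall_pos_lt_add fun ε hε => ?_
  obtain ⟨r, hr, h⟩ := exists_lt_of_csInf_lt (s := {r | G.PathOfLength p q r}) (exists_path p q)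
    (show _ < G.dist p q + ε / 2 from lt_add_of_pos_right _ (half_pos hε))
  obtain ⟨r', hr', h'⟩ := exists_lt_of_csInf_lt (s := {r | G.PathOfLength q s r}) (exists_path q s)
    (show _ < G.dist q s + ε / 2 from lt_add_of_pos_right _ (half_pos hε))
  have := (PathOfLength.trans _ _ _ _ _ hr hr').dist_le
  linarith

lemma dist_eq_zero_of_isAt {p q : G.Point} {a : G.V} (hp : p.IsAt a) (hq : q.IsAt a) :
    G.dist p q = 0 :=
  le_antisymm (PathOfLength.vertex p q a hp hq).dist_le (dist_nonneg p q)

lemma dist_le_of_edge_eq {p q : G.Point} (h : p.edge = q.edge) : G.dist p q ≤ |p.pos - q.pos| :=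
  (PathOfLength.segment p q h).dist_le

@[simp] lemma dist_self (p : G.Point) : G.dist p p = 0 :=
  le_antisymm (by simpa using dist_le_of_edge_eq (p := p) rfl) (dist_nonneg p p)

lemma dist_point_le {e : G.E} {s t : ℝ} (hs : s ∈ Set.Icc 0 (G.len e))
    (ht : t ∈ Set.Icc 0 (G.len e)) : G.dist (G.point e s) (G.point e t) ≤ |s - t| := by
  simpa [point_pos hs, point_pos ht] using
    dist_le_of_edge_eq (show (G.point e s).edge = (G.point e t).edge from rfl)

lemma abs_dist_sub_dist_le (x p q : G.Point) : |G.dist x p - G.dist x q| ≤ G.dist p q := by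
  rw [abs_le]
  have h1 := dist_triangle x p q
  have h2 := dist_triangle x q p
  rw [dist_comm q p] at h2
  constructor <;> linarith

/-- Two points with the same location in the graph. -/
def Glued (p q : G.Point) : Prop := p = q ∨ ∃ a, p.IsAt a ∧ q.IsAt a

lemma Glued.dist_eq_zero {p q : G.Point} (h : Glued p q) : G.dist p q = 0 := by
  obtain rfl | ⟨a, hp, hq⟩ := h
  · exact dist_self _
  · exact dist_eq_zero_of_isAt hp hq

lemma dist_eq_of_isAt (x : G.Point) {p q : G.Point} (h : G.dist p q = 0) :
    G.dist x p = G.dist x q := by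
  have := abs_dist_sub_dist_le x p q
  rw [h] at this
  linarith [abs_nonpos_iff.1 this]

lemma exists_vertex_dist (x : G.Point) :
    ∃ κ : G.V → ℝ, ∀ (p : G.Point) (a : G.V), p.IsAt a → G.dist x p = κ a := by
  classical
  -- The default value 0 concerns only a vertex represented by no point, about which nothing is
  -- claimed.
  refine ⟨fun a => if h : ∃ p : G.Point, p.IsAt a then G.dist x h.choose else 0, fun p a hp => ?_⟩
  have h : ∃ p : G.Point, p.IsAt a := ⟨p, hp⟩
  simp only [h, dif_pos]
  exact dist_eq_of_isAt x (dist_eq_zero_of_isAt hp h.choose_spec)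

/-! ### Distances and vertex potentials -/

/-- A function that is compatible with the gluing and `1`-Lipschitz along the edges bounds the
length of a path from below. -/
lemma sub_le_dist_of_lipschitz (K : G.Point → ℝ)
    (hseg : ∀ p q : G.Point, p.edge = q.edge → K q ≤ K p + |p.pos - q.pos|)
    (hvert : ∀ p q a, p.IsAt a → q.IsAt a → K p = K q) (p q : G.Point) :
    K q - K p ≤ G.dist p q := by
  refine le_csInf (exists_path p q) fun r hr => ?_
  induction hr with
  | segment p q h => linarith [hseg p q h]
  | vertex p q a hp hq => linarith [hvert p q a hp hq]
  | trans p q s r r' _ _ h h' => linarith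

/-- The function on the graph with vertex values `κ`, interpolated on the edges by the distance. -/
noncomputable def interp (κ : G.V → ℝ) (p : G.Point) : ℝ :=
  min (κ (G.src p.edge) + p.pos) (κ (G.tgt p.edge) + (G.len p.edge - p.pos))

/-- The same with an additional source at `x`. -/
noncomputable def interpFrom (κ : G.V → ℝ) (x p : G.Point) : ℝ :=
  open Classical in
  if x.edge = p.edge then min |p.pos - x.pos| (interp κ p) else interp κ p

lemma interp_le (κ : G.V → ℝ) {p q : G.Point} (h : p.edge = q.edge) :
    interp κ q ≤ interp κ p + |p.pos - q.pos| := by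
  unfold interp
  rw [h, min_add, le_min_iff]
  constructor
  · exact (min_le_left _ _).trans (by linarith [neg_abs_le (p.pos - q.pos)])
  · exact (min_le_right _ _).trans (by linarith [le_abs_self (p.pos - q.pos)])

lemma interpFrom_le (κ : G.V → ℝ) (x : G.Point) {p q : G.Point} (h : p.edge = q.edge) :
    interpFrom κ x q ≤ interpFrom κ x p + |p.pos - q.pos| := by
  unfold interpFrom
  rw [h]
  split_ifs
  · rw [min_add, le_min_iff]
    constructor
    · refine (min_le_left _ _).trans ?_
      have := abs_sub_le q.pos p.pos x.pos
      rw [abs_sub_comm q.pos p.pos] at this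
      linarith
    · exact (min_le_right _ _).trans (interp_le κ h)
  · exact interp_le κ h

/-- The hypotheses make `κ` admissible: neither crossing an edge nor starting at `x` reaches a
vertex more cheaply than its own value, so all representatives of `a` receive the same value. -/
lemma interpFrom_isAt (κ : G.V → ℝ) (x : G.Point)
    (hκ : ∀ e, |κ (G.src e) - κ (G.tgt e)| ≤ G.len e)
    (hs : κ (G.src x.edge) ≤ x.pos) (ht : κ (G.tgt x.edge) ≤ G.len x.edge - x.pos)
    {p : G.Point} {a : G.V} (hp : p.IsAt a) : interpFrom κ x p = κ a := by
  have h1 := abs_le.1 (hκ p.edge)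
  have h2 : interp κ p = κ a := by
    obtain ⟨h, rfl⟩ | ⟨h, rfl⟩ := hp
    · rw [interp, h, min_eq_left] <;> linarith
    · rw [interp, h, min_eq_right] <;> linarith
  unfold interpFrom
  split_ifs with he
  · rw [h2, min_eq_right]
    have := x.pos_mem
    obtain ⟨h, rfl⟩ | ⟨h, rfl⟩ := hp
    · rw [h, ← he, zero_sub, abs_neg]
      exact hs.trans (le_abs_self _)
    · rw [h, ← he]
      exact ht.trans (le_abs_self _)
  · exact h2

/-- Lower bounds for the distance from `x` by means of a potential on the vertices. -/
lemma interpFrom_le_dist (κ : G.V → ℝ) (x : G.Point)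
    (hκ : ∀ e, |κ (G.src e) - κ (G.tgt e)| ≤ G.len e)
    (hs : κ (G.src x.edge) ≤ x.pos) (ht : κ (G.tgt x.edge) ≤ G.len x.edge - x.pos)
    (p : G.Point) : interpFrom κ x p ≤ G.dist x p := by
  have h := sub_le_dist_of_lipschitz (interpFrom κ x) (fun p q h => interpFrom_le κ x h)
    (fun p q a hp hq => (interpFrom_isAt κ x hκ hs ht hp).trans
      (interpFrom_isAt κ x hκ hs ht hq).symm) x p
  have : interpFrom κ x x ≤ 0 := by
    unfold interpFrom
    rw [if_pos rfl]
    exact (min_le_left _ _).trans (by simp)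
  linarith

/-- A shortest path to `p` either stays on the edge of `x` or enters the edge of `p` through one of
its ends. The triangle inequality gives one bound; the other is `interpFrom_le_dist`, since the true
distances are an admissible potential. -/
lemma dist_eq_interpFrom {κ : G.V → ℝ} {x : G.Point}
    (hκ : ∀ (p : G.Point) (a : G.V), p.IsAt a → G.dist x p = κ a) (p : G.Point) :
    G.dist x p = interpFrom κ x p := by
  have h0 : ∀ q : G.Point, G.dist x q ≤ κ (G.src q.edge) + q.pos ∧
      G.dist x q ≤ κ (G.tgt q.edge) + (G.len q.edge - q.pos) := by
    intro q
    have h1 := dist_triangle x (G.point q.edge 0) q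
    have h2 := dist_triangle x (G.point q.edge (G.len q.edge)) q
    rw [hκ _ _ (isAt_src _)] at h1
    rw [hκ _ _ (isAt_tgt _)] at h2
    have h3 := dist_le_of_edge_eq (show (G.point q.edge 0).edge = q.edge from rfl)
    have h4 := dist_le_of_edge_eq (show (G.point q.edge (G.len q.edge)).edge = q.edge from rfl)
    rw [point_pos (zero_mem _), zero_sub, abs_neg, abs_of_nonneg q.pos_mem.1] at h3
    rw [point_pos (len_mem _), abs_of_nonneg (by linarith [q.pos_mem.2])] at h4
    constructor <;> linarith
  refine le_antisymm ?_ (interpFrom_le_dist κ x ?_ ?_ ?_ p)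
  · unfold interpFrom interp
    split_ifs with he
    · refine le_min ?_ (le_min (h0 p).1 (h0 p).2)
      rw [abs_sub_comm]
      exact dist_le_of_edge_eq he
    · exact le_min (h0 p).1 (h0 p).2
  · intro e
    rw [← hκ _ _ (isAt_src e), ← hκ _ _ (isAt_tgt e)]
    refine (abs_dist_sub_dist_le _ _ _).trans ((dist_point_le (zero_mem e) (len_mem e)).trans ?_)
    simp [abs_of_pos (G.len_pos e)]
  · rw [← hκ _ _ (isAt_src _)]
    have h3 := dist_le_of_edge_eq (show x.edge = (G.point x.edge 0).edge from rfl)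
    rwa [point_pos (zero_mem _), sub_zero, abs_of_nonneg x.pos_mem.1] at h3
  · rw [← hκ _ _ (isAt_tgt _)]
    have h4 := dist_le_of_edge_eq (show x.edge = (G.point x.edge (G.len x.edge)).edge from rfl)
    rwa [point_pos (len_mem _), abs_sub_comm, abs_of_nonneg (by linarith [x.pos_mem.2])] at h4

/-! ### The length measure of the graph -/

instance instMeasurableSpaceE (G : MetricGraph.{u, v}) : MeasurableSpace G.E := ⊤

instance instDiscreteMeasurableSpaceE (G : MetricGraph.{u, v}) : DiscreteMeasurableSpace G.E :=
  ⟨fun _ => trivial⟩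

/-- The Lebesgue measure of the graph, on pairs of an edge and a parameter. -/
noncomputable def vol (G : MetricGraph.{u, v}) : Measure (G.E × ℝ) :=
  ∑ e : G.E, (volume.restrict (Set.Icc 0 (G.len e))).map (Prod.mk e)

lemma measurableEmbedding_mk (e : G.E) : MeasurableEmbedding (Prod.mk e : ℝ → G.E × ℝ) :=
  measurableEmbedding_prodMk_left e

lemma integrable_vol {F : G.E × ℝ → ℝ} :
    Integrable F G.vol ↔ ∀ e, IntegrableOn (fun t => F (e, t)) (Set.Icc 0 (G.len e)) := by
  unfold vol
  rw [integrable_finsetSum_measure]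
  simp only [Finset.mem_univ, true_imp_iff, (measurableEmbedding_mk _).integrable_map_iff]
  rfl

lemma integral_vol {F : G.E × ℝ → ℝ} (hF : Integrable F G.vol) :
    ∫ z, F z ∂G.vol = ∑ e, ∫ t in 0..G.len e, F (e, t) := by
  have hF' := hF
  unfold vol at hF' ⊢
  rw [integrable_finsetSum_measure] at hF'
  rw [integral_finsetSum_measure hF']
  refine Finset.sum_congr rfl fun e _ => ?_
  rw [(measurableEmbedding_mk e).integral_map, intervalIntegral.integral_of_le (G.len_pos e).le,
    integral_Icc_eq_integral_Ioc]

lemma vol_apply {A : Set (G.E × ℝ)} (hA : MeasurableSet A) :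
    G.vol A = ∑ e, volume (Prod.mk e ⁻¹' A ∩ Set.Icc 0 (G.len e)) := by
  unfold vol
  rw [Measure.finsetSum_apply]
  refine Finset.sum_congr rfl fun e _ => ?_
  rw [Measure.map_apply measurable_prodMk_left hA,
    Measure.restrict_apply (measurable_prodMk_left hA)]

instance instIsFiniteMeasureVol : IsFiniteMeasure G.vol := by
  refine ⟨?_⟩
  rw [vol_apply .univ]
  simp

/-- The distance from `x` of the point with the given parameters. -/
noncomputable def distFrom (x : G.Point) (z : G.E × ℝ) : ℝ := G.dist x (G.point z.1 z.2)

/-- Continuity holds on all of ℝ because `point` clamps its parameter to the edge. -/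
lemma continuous_distFrom (x : G.Point) (e : G.E) : Continuous fun t => distFrom x (e, t) := by
  refine (LipschitzWith.of_dist_le_mul (K := 1) fun s t => ?_).continuous
  rw [Real.dist_eq, Real.dist_eq, NNReal.coe_one, one_mul]
  refine (abs_dist_sub_dist_le _ _ _).trans ((dist_le_of_edge_eq
    (show (G.point e s).edge = (G.point e t).edge from rfl)).trans ?_)
  exact Set.abs_projIcc_sub_projIcc (G.len_pos e).le

lemma measurable_distFrom (x : G.Point) : Measurable (distFrom x) :=
  measurable_from_prod_countable_right fun e => (continuous_distFrom x e).measurable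

/-! ### Shortest paths -/

/-- `γ` is a shortest path from `x`, parametrised by arc length on `[0, r]`; `σ` is its orientation
relative to the parametrisations of the edges. -/
structure IsGeodesic (x : G.Point) (r : ℝ) (γ : ℝ → G.E × ℝ) (σ : ℝ → ℝ) : Prop where
  measurable : Measurable γ
  measurable_sign : Measurable σ
  abs_sign : ∀ s, |σ s| = 1
  mem : ∀ s ∈ Set.Icc 0 r, (γ s).2 ∈ Set.Icc 0 (G.len (γ s).1)
  distFrom_eq : ∀ s ∈ Set.Icc 0 r, distFrom x (γ s) = s
  dist_le : ∀ s ∈ Set.Icc 0 r, ∀ t ∈ Set.Icc 0 r,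
    G.dist (G.point (γ s).1 (γ s).2) (G.point (γ t).1 (γ t).2) ≤ |s - t|
  -- The path covers no length twice. Localising the bound to points closer than `r` lets the bounds
  -- for successive pieces be added in `IsGeodesic.extend`.
  map_le : (volume.restrict (Set.Ico 0 r)).map γ ≤ G.vol.restrict {z | distFrom x z < r}
  eval : ∀ w : G.H1, ∀ s ∈ Set.Icc 0 r, w.toFun (γ s).1 (γ s).2 =
    w.toFun x.edge x.pos + ∫ t in 0..s, σ t * w.der (γ t).1 (γ t).2

lemma IsGeodesic.map_le_vol {x : G.Point} {r : ℝ} {γ : ℝ → G.E × ℝ} {σ : ℝ → ℝ}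
    (h : IsGeodesic x r γ σ) : (volume.restrict (Set.Ico 0 r)).map γ ≤ G.vol :=
  h.map_le.trans Measure.restrict_le_self

lemma IsGeodesic.integrableOn {x : G.Point} {r : ℝ} {γ : ℝ → G.E × ℝ} {σ : ℝ → ℝ}
    (h : IsGeodesic x r γ σ) {F : G.E × ℝ → ℝ} (hF : Integrable F G.vol) :
    IntegrableOn (fun s => F (γ s)) (Set.Ico 0 r) :=
  (hF.mono_measure h.map_le_vol).comp_measurable h.measurable

lemma IsGeodesic.intervalIntegrable {x : G.Point} {r : ℝ} {γ : ℝ → G.E × ℝ} {σ : ℝ → ℝ}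
    (h : IsGeodesic x r γ σ) (hr : 0 ≤ r) {F : G.E × ℝ → ℝ} (hF : Integrable F G.vol) :
    IntervalIntegrable (fun s => F (γ s)) volume 0 r := by
  rw [intervalIntegrable_iff_integrableOn_Ico_of_le hr]
  exact h.integrableOn hF

lemma IsGeodesic.integral_le {x : G.Point} {r : ℝ} {γ : ℝ → G.E × ℝ} {σ : ℝ → ℝ}
    (h : IsGeodesic x r γ σ) (hr : 0 ≤ r) {F : G.E × ℝ → ℝ} (hF : Integrable F G.vol)
    (h0 : 0 ≤ᵐ[G.vol] F) : ∫ s in 0..r, F (γ s) ≤ ∫ z, F z ∂G.vol := by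
  rw [intervalIntegral.integral_of_le hr, ← integral_Ico_eq_integral_Ioc,
    ← integral_map (f := F) h.measurable.aemeasurable
      (hF.mono_measure h.map_le_vol).aestronglyMeasurable]
  exact integral_mono_measure h.map_le_vol h0 hF

lemma ae_vol {P : G.E × ℝ → Prop} (h : ∀ e, ∀ t ∈ Set.Icc 0 (G.len e), P (e, t)) :
    ∀ᵐ z ∂G.vol, P z := by
  have hm : MeasurableSet {z : G.E × ℝ | z.2 ∈ Set.Icc 0 (G.len z.1)} := by
    have h1 : Measurable fun z : G.E × ℝ => G.len z.1 :=
      (measurable_of_countable _).comp measurable_fst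
    exact (measurableSet_le measurable_const measurable_snd).inter
      (measurableSet_le measurable_snd h1)
  have : ∀ᵐ z ∂G.vol, z.2 ∈ Set.Icc 0 (G.len z.1) := by
    rw [ae_iff]
    have h2 := vol_apply (G := G) hm.compl
    refine (Eq.trans (by rfl) h2).trans (Finset.sum_eq_zero fun e _ => ?_)
    convert measure_empty (μ := volume)
    ext t
    simp
  filter_upwards [this] with z hz using h z.1 z.2 hz

lemma H1.integrable_der_sq (w : G.H1) : Integrable (fun z => w.der z.1 z.2 ^ 2) G.vol :=
  integrable_vol.2 fun e => (w.der_memLp e).integrable_sq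

lemma H1.integrable_der (w : G.H1) : Integrable (fun z => w.der z.1 z.2) G.vol :=
  integrable_vol.2 fun e => (w.der_memLp e).integrable one_le_two

lemma H1.intervalIntegrable_der (w : G.H1) {e : G.E} {s t : ℝ} (hs : s ∈ Set.Icc 0 (G.len e))
    (ht : t ∈ Set.Icc 0 (G.len e)) : IntervalIntegrable (w.der e) volume s t := by
  have : IntegrableOn (w.der e) (Set.Icc 0 (G.len e)) := (w.der_memLp e).integrable one_le_two
  exact (this.mono_set (Set.uIcc_subset_Icc hs ht)).intervalIntegrable

lemma H1.toFun_sub (w : G.H1) {e : G.E} {s t : ℝ} (hs : s ∈ Set.Icc 0 (G.len e))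
    (ht : t ∈ Set.Icc 0 (G.len e)) : w.toFun e t = w.toFun e s + ∫ x in s..t, w.der e x := by
  rw [w.eq_integral e s hs, w.eq_integral e t ht, add_assoc,
    intervalIntegral.integral_add_adjacent_intervals]
  · exact w.intervalIntegrable_der (zero_mem e) hs
  · exact w.intervalIntegrable_der hs ht

lemma H1.toFun_eq_of_glued (w : G.H1) {p q : G.Point} (h : Glued p q) :
    w.toFun p.edge p.pos = w.toFun q.edge q.pos := by
  obtain ⟨val, hval⟩ := w.continuous_vertex
  have key : ∀ (p : G.Point) (a : G.V), p.IsAt a → w.toFun p.edge p.pos = val a := by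
    rintro p a (⟨h, rfl⟩ | ⟨h, rfl⟩)
    · rw [h, (hval _).1]
    · rw [h, (hval _).2]
  obtain rfl | ⟨a, hp, hq⟩ := h
  · rfl
  · rw [key p a hp, key q a hq]

lemma IsGeodesic.intervalIntegrable_der {x : G.Point} {r : ℝ} {γ : ℝ → G.E × ℝ} {σ : ℝ → ℝ}
    (h : IsGeodesic x r γ σ) (hr : 0 ≤ r) (w : G.H1) :
    IntervalIntegrable (fun t => σ t * w.der (γ t).1 (γ t).2) volume 0 r := by
  have h1 := h.intervalIntegrable hr w.integrable_der
  rw [intervalIntegrable_iff] at h1 ⊢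
  exact h1.bdd_mul (c := 1) h.measurable_sign.aestronglyMeasurable
    (.of_forall fun s => by rw [Real.norm_eq_abs, h.abs_sign])

lemma isGeodesic_zero (x : G.Point) :
    IsGeodesic x 0 (fun _ => (x.edge, x.pos)) (fun _ => 1) where
  measurable := measurable_const
  measurable_sign := measurable_const
  abs_sign _ := abs_one
  mem _ _ := x.pos_mem
  distFrom_eq s hs := by
    rw [Set.Icc_self] at hs
    rw [Set.mem_singleton_iff.1 hs]
    simp [distFrom]
  dist_le _ _ _ _ := by simp
  map_le := by simp [Measure.zero_le]
  eval w s hs := by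
    rw [Set.Icc_self] at hs
    rw [Set.mem_singleton_iff.1 hs]
    simp

/-- A shortest path can be continued along an edge as long as the distance grows. -/
lemma IsGeodesic.extend {x : G.Point} {r : ℝ} {γ : ℝ → G.E × ℝ} {σ : ℝ → ℝ}
    (h : IsGeodesic x r γ σ) (hr : 0 ≤ r) {e : G.E} {α ε T : ℝ} (hε : ε = 1 ∨ ε = -1)
    (hT : 0 ≤ T) (hα : α ∈ Set.Icc 0 (G.len e)) (hβ : α + ε * T ∈ Set.Icc 0 (G.len e))
    (hg : Glued (G.point (γ r).1 (γ r).2) (G.point e α))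
    (hd : G.dist x (G.point e (α + ε * T)) = r + T) :
    ∃ γ' σ', IsGeodesic x (r + T) γ' σ' ∧ γ' (r + T) = (e, α + ε * T) := by
  have hε1 : |ε| = 1 := by rcases hε with rfl | rfl <;> simp
  have hrr : r ∈ Set.Icc 0 r := ⟨hr, le_rfl⟩
  have hmem : ∀ t, 0 ≤ t → t ≤ T → α + ε * t ∈ Set.Icc 0 (G.len e) := by
    intro t ht ht'
    obtain ⟨h1, h2⟩ := hα
    obtain ⟨h3, h4⟩ := hβ
    rcases hε with rfl | rfl <;> constructor <;> linarith
  have hstart : G.dist x (G.point e α) = r := by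
    rw [← dist_eq_of_isAt x hg.dist_eq_zero]
    exact h.distFrom_eq r hrr
  have hseg : ∀ s t, 0 ≤ s → s ≤ T → 0 ≤ t → t ≤ T →
      G.dist (G.point e (α + ε * s)) (G.point e (α + ε * t)) ≤ |s - t| := by
    intro s t hs hs' ht ht'
    refine (dist_point_le (hmem s hs hs') (hmem t ht ht')).trans_eq ?_
    rw [show α + ε * s - (α + ε * t) = ε * (s - t) by ring, abs_mul, hε1, one_mul]
  -- The distance from `x` grows at most at unit rate and has grown by `T` at the end of the piece,
  -- so it grows at exactly unit rate throughout.
  have hdist : ∀ t, 0 ≤ t → t ≤ T → G.dist x (G.point e (α + ε * t)) = r + t := by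
    intro t ht ht'
    have h1 := hseg 0 t le_rfl hT ht ht'
    have h2 := hseg t T ht ht' hT le_rfl
    rw [mul_zero, add_zero, zero_sub, abs_neg, abs_of_nonneg ht] at h1
    rw [abs_sub_comm, abs_of_nonneg (by linarith)] at h2
    have h3 := dist_triangle x (G.point e α) (G.point e (α + ε * t))
    have h4 := dist_triangle x (G.point e (α + ε * t)) (G.point e (α + ε * T))
    linarith
  let γ' : ℝ → G.E × ℝ := fun s => if s < r then γ s else (e, α + ε * (s - r))
  let σ' : ℝ → ℝ := fun s => if s < r then σ s else ε
  have hγ1 : ∀ s, s < r → γ' s = γ s := fun s hs => if_pos hs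
  have hγ2 : ∀ s, r ≤ s → γ' s = (e, α + ε * (s - r)) := fun s hs => if_neg (not_lt.2 hs)
  have hσ1 : ∀ s, s < r → σ' s = σ s := fun s hs => if_pos hs
  have hσ2 : ∀ s, r ≤ s → σ' s = ε := fun s hs => if_neg (not_lt.2 hs)
  have hmeas2 : Measurable fun s : ℝ => ((e, α + ε * (s - r)) : G.E × ℝ) :=
    measurable_const.prodMk (by fun_prop)
  have hmeas : Measurable γ' := Measurable.ite measurableSet_Iio h.measurable hmeas2
  have hcross : ∀ s, 0 ≤ s → s < r → ∀ t, r ≤ t → t ≤ r + T →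
      G.dist (G.point (γ' s).1 (γ' s).2) (G.point (γ' t).1 (γ' t).2) ≤ t - s := by
    intro s hs hs' t ht ht'
    rw [hγ1 s hs', hγ2 t ht]
    have h1 := h.dist_le s ⟨hs, hs'.le⟩ r hrr
    have h2 := hseg 0 (t - r) le_rfl hT (by linarith) (by linarith)
    rw [mul_zero, add_zero, zero_sub, abs_neg, abs_of_nonneg (by linarith)] at h2
    rw [abs_sub_comm, abs_of_nonneg (by linarith)] at h1
    have h3 := dist_triangle (G.point (γ s).1 (γ s).2) (G.point (γ r).1 (γ r).2) (G.point e α)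
    have h4 := dist_triangle (G.point (γ s).1 (γ s).2) (G.point e α)
      (G.point e (α + ε * (t - r)))
    rw [hg.dist_eq_zero] at h3
    simp only
    linarith
  refine ⟨γ', σ', ⟨hmeas, Measurable.ite measurableSet_Iio h.measurable_sign measurable_const,
    ?_, ?_, ?_, ?_, ?_, ?_⟩, ?_⟩
  · intro s
    obtain hs | hs := lt_or_ge s r
    · rw [hσ1 s hs, h.abs_sign]
    · rw [hσ2 s hs, hε1]
  · rintro s ⟨hs0, hs1⟩
    obtain hs | hs := lt_or_ge s r
    · rw [hγ1 s hs]
      exact h.mem s ⟨hs0, hs.le⟩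
    · rw [hγ2 s hs]
      exact hmem _ (by linarith) (by linarith)
  · rintro s ⟨hs0, hs1⟩
    obtain hs | hs := lt_or_ge s r
    · rw [hγ1 s hs]
      exact h.distFrom_eq s ⟨hs0, hs.le⟩
    · rw [hγ2 s hs]
      refine (hdist _ (by linarith) (by linarith)).trans (by ring)
  · rintro s ⟨hs0, hs1⟩ t ⟨ht0, ht1⟩
    obtain hs | hs := lt_or_ge s r <;> obtain ht | ht := lt_or_ge t r
    · rw [hγ1 s hs, hγ1 t ht]
      exact h.dist_le s ⟨hs0, hs.le⟩ t ⟨ht0, ht.le⟩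
    · rw [abs_sub_comm]
      exact (hcross s hs0 hs t ht ht1).trans (le_abs_self _)
    · rw [dist_comm]
      exact (hcross t ht0 ht s hs hs1).trans (le_abs_self _)
    · rw [hγ2 s hs, hγ2 t ht]
      refine (hseg _ _ (by linarith) (by linarith) (by linarith) (by linarith)).trans_eq ?_
      congr 1
      ring
  -- The old path lies at distances below `r` and the new piece at distances in `[r, r + T)`; these
  -- regions are disjoint, so the two push-forward bounds add up.
  · have hm := measurable_distFrom x
    have hA1 : MeasurableSet {z | distFrom x z < r} := measurableSet_lt hm measurable_const
    have hA2 : MeasurableSet {z | r ≤ distFrom x z ∧ distFrom x z < r + T} :=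
      (measurableSet_le measurable_const hm).inter (measurableSet_lt hm measurable_const)
    have hunion : {z | distFrom x z < r + T} =
        {z | distFrom x z < r} ∪ {z | r ≤ distFrom x z ∧ distFrom x z < r + T} := by
      ext z
      simp only [Set.mem_ofPred_eq, Set.mem_union]
      constructor
      · intro hz
        obtain h | h := lt_or_ge (distFrom x z) r
        · exact .inl h
        · exact .inr ⟨h, hz⟩
      · rintro (hz | hz)
        · linarith
        · exact hz.2
    have hdisj : Disjoint {z | distFrom x z < r}
        {z | r ≤ distFrom x z ∧ distFrom x z < r + T} :=
      Set.disjoint_left.2 fun z hz hz' => not_le.2 hz hz'.1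
    rw [hunion, Measure.restrict_union hdisj hA2,
      ← Set.Ico_union_Ico_eq_Ico hr (show r ≤ r + T by linarith),
      Measure.restrict_union (Set.Ico_disjoint_Ico_same) measurableSet_Ico,
      Measure.map_add _ _ hmeas]
    refine add_le_add ?_ ?_
    · refine le_trans (le_of_eq (Measure.map_congr ?_)) h.map_le
      filter_upwards [ae_restrict_mem measurableSet_Ico] with s hs using hγ1 s hs.2
    · refine Measure.le_iff.2 fun A hA => ?_
      rw [Measure.map_apply hmeas hA, Measure.restrict_apply (hmeas hA), Measure.restrict_apply hA]
      set B := A ∩ {z | r ≤ distFrom x z ∧ distFrom x z < r + T} with hB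
      have hBm : MeasurableSet B := hA.inter hA2
      rw [vol_apply hBm]
      refine le_trans ?_ (Finset.single_le_sum (f := fun e =>
        volume (Prod.mk e ⁻¹' B ∩ Set.Icc 0 (G.len e))) (fun _ _ => zero_le)
        (Finset.mem_univ e))
      have hmp : MeasurePreserving (fun s : ℝ => α + ε * (s - r)) := by
        rcases hε with rfl | rfl
        · rw [show (fun s : ℝ => α + 1 * (s - r)) = fun s => α - r + s by ext s; ring]
          exact measurePreserving_add_left volume (α - r)
        · rw [show (fun s : ℝ => α + -1 * (s - r)) = fun s => α + r - s by ext s; ring]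
          exact Measure.measurePreserving_sub_left volume (α + r)
      rw [← hmp.measure_preimage
        ((measurable_prodMk_left hBm).inter measurableSet_Icc).nullMeasurableSet]
      refine measure_mono ?_
      rintro s ⟨hs, hs1, hs2⟩
      have h1 := hdist (s - r) (by linarith) (by linarith)
      rw [Set.mem_preimage, hγ2 s hs1] at hs
      refine ⟨⟨hs, ?_⟩, hmem _ (by linarith) (by linarith)⟩
      simp only [Set.mem_ofPred_eq, distFrom, h1]
      constructor <;> linarith
  · rintro w s ⟨hs0, hs1⟩
    have hint : ∀ s, 0 ≤ s → s ≤ r →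
        ∫ t in 0..s, σ' t * w.der (γ' t).1 (γ' t).2 = ∫ t in 0..s, σ t * w.der (γ t).1 (γ t).2 := by
      intro s hs hs'
      rw [intervalIntegral.integral_of_le hs, intervalIntegral.integral_of_le hs,
        ← integral_Ico_eq_integral_Ioc, ← integral_Ico_eq_integral_Ioc]
      refine setIntegral_congr_fun measurableSet_Ico fun t ht => ?_
      simp only [hσ1 t (ht.2.trans_le hs'), hγ1 t (ht.2.trans_le hs')]
    obtain hs | hs := lt_or_ge s r
    · rw [hγ1 s hs, hint s hs0 hs.le]
      exact h.eval w s ⟨hs0, hs.le⟩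
    · have hi : IntervalIntegrable (fun t => σ' t * w.der (γ' t).1 (γ' t).2) volume 0 r := by
        have h1 : IntervalIntegrable (fun t => σ t * w.der (γ t).1 (γ t).2) volume 0 r :=
          h.intervalIntegrable_der hr w
        rw [intervalIntegrable_iff_integrableOn_Ico_of_le hr] at h1 ⊢
        refine h1.congr_fun (fun t ht => ?_) measurableSet_Ico
        simp only [hσ1 t ht.2, hγ1 t ht.2]
      have hseq : Set.EqOn (fun t => ε * w.der e (α + ε * (t - r)))
          (fun t => σ' t * w.der (γ' t).1 (γ' t).2) (Set.uIcc r s) := by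
        intro t ht
        rw [Set.uIcc_of_le hs] at ht
        simp only [hσ2 t ht.1, hγ2 t ht.1]
      have hmid := hmem (s - r) (by linarith) (by linarith)
      have hi2 : IntervalIntegrable (fun t => ε * w.der e (α + ε * (t - r))) volume r s := by
        have := (((w.intervalIntegrable_der hα hmid).comp_add_left α).comp_mul_left
          (c := ε)).comp_sub_right r
        rw [sub_self, zero_div, zero_add, add_sub_cancel_left,
          mul_div_cancel_left₀ _ (by rcases hε with rfl | rfl <;> norm_num),
          sub_add_cancel] at this
        exact this.const_mul ε
      have hsub : ∫ t in r..s, ε * w.der e (α + ε * (t - r)) =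
          ∫ t in α..α + ε * (s - r), w.der e t := by
        rw [intervalIntegral.integral_const_mul,
          intervalIntegral.integral_comp_sub_right (fun t => w.der e (α + ε * t)),
          intervalIntegral.mul_integral_comp_add_mul, sub_self, mul_zero, add_zero]
      rw [← intervalIntegral.integral_add_adjacent_intervals hi
        (hi2.congr (fun t ht => hseq (Set.uIoc_subset_uIcc ht))), hint r hr le_rfl,
        ← intervalIntegral.integral_congr hseq, hsub, ← add_assoc, ← h.eval w r hrr, hγ2 s hs]
      have h1 := w.toFun_eq_of_glued hg
      rw [point_pos (h.mem r hrr), point_pos hα] at h1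
      simp only [point_edge] at h1
      rw [h1]
      exact w.toFun_sub hα hmid
  · rw [hγ2 _ (by linarith)]
    simp

lemma eventually_add_le {a b : ℝ} (h : a < b) :
    ∀ᶠ δ in nhdsWithin (0 : ℝ) (Set.Ioi 0), a + δ ≤ b := by
  have : Filter.Tendsto (fun δ : ℝ => a + δ) (nhdsWithin 0 (Set.Ioi 0)) (nhds (a + 0)) :=
    (Continuous.tendsto (by fun_prop) 0).mono_left nhdsWithin_le_nhds
  rw [add_zero] at this
  exact this.eventually_le_const h

/-- A shortest path between any two points. -/
theorem exists_isGeodesic (x y : G.Point) :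
    ∃ γ σ, IsGeodesic x (G.dist x y) γ σ ∧ γ (G.dist x y) = (y.edge, y.pos) := by
  obtain ⟨κ, hκ⟩ := exists_vertex_dist x
  have hsrc : ∀ e, G.dist x (G.point e 0) = κ (G.src e) := fun e => hκ _ _ (isAt_src e)
  have htgt : ∀ e, G.dist x (G.point e (G.len e)) = κ (G.tgt e) := fun e => hκ _ _ (isAt_tgt e)
  -- `R a`: the distance from `x` to `a` is realised by a shortest path.
  let R : G.V → Prop := fun a => ∃ γ σ, IsGeodesic x (κ a) γ σ ∧
    (G.point (γ (κ a)).1 (γ (κ a)).2).IsAt a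
  have hs1 : ∀ e, R (G.src e) → ∀ t ∈ Set.Icc 0 (G.len e),
      G.dist x (G.point e t) = κ (G.src e) + t →
      ∃ γ σ, IsGeodesic x (κ (G.src e) + t) γ σ ∧ γ (κ (G.src e) + t) = (e, t) := by
    rintro e ⟨γ, σ, h, hat⟩ t ht hd
    have := h.extend (by rw [← hsrc]; exact dist_nonneg _ _) (e := e) (α := 0) (ε := 1) (T := t)
      (.inl rfl) ht.1 (zero_mem e) (by simpa using ht) (.inr ⟨_, hat, isAt_src e⟩)
      (by simpa using hd)
    simpa using this
  have hs2 : ∀ e, R (G.tgt e) → ∀ t ∈ Set.Icc 0 (G.len e),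
      G.dist x (G.point e t) = κ (G.tgt e) + (G.len e - t) →
      ∃ γ σ, IsGeodesic x (κ (G.tgt e) + (G.len e - t)) γ σ ∧
        γ (κ (G.tgt e) + (G.len e - t)) = (e, t) := by
    rintro e ⟨γ, σ, h, hat⟩ t ht hd
    have := h.extend (by rw [← htgt]; exact dist_nonneg _ _) (e := e) (α := G.len e) (ε := -1)
      (T := G.len e - t) (.inr rfl) (by linarith [ht.2]) (len_mem e) (by simpa using ht)
      (.inr ⟨_, hat, isAt_tgt e⟩) (by simpa using hd)
    simpa using this
  have hs3 : ∀ t ∈ Set.Icc 0 (G.len x.edge), G.dist x (G.point x.edge t) = |t - x.pos| →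
      ∃ γ σ, IsGeodesic x |t - x.pos| γ σ ∧ γ |t - x.pos| = (x.edge, t) := by
    intro t ht hd
    obtain h | h := le_total x.pos t
    · rw [abs_of_nonneg (sub_nonneg.2 h)] at hd ⊢
      have := (isGeodesic_zero x).extend le_rfl (e := x.edge) (α := x.pos) (ε := 1)
        (T := t - x.pos) (.inl rfl) (by linarith) x.pos_mem (by simpa using ht)
        (.inl rfl) (by simpa using hd)
      simpa using this
    · rw [abs_of_nonpos (sub_nonpos.2 h), neg_sub] at hd ⊢
      have := (isGeodesic_zero x).extend le_rfl (e := x.edge) (α := x.pos) (ε := -1)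
        (T := x.pos - t) (.inr rfl) (by linarith) x.pos_mem (by simpa using ht)
        (.inl rfl) (by simpa using hd)
      simpa using this
  have hlen : ∀ e, |κ (G.src e) - κ (G.tgt e)| ≤ G.len e := by
    intro e
    rw [← hsrc, ← htgt]
    refine (abs_dist_sub_dist_le _ _ _).trans ((dist_point_le (zero_mem e) (len_mem e)).trans ?_)
    simp [abs_of_pos (G.len_pos e)]
  have hx := x.pos_mem
  have hsx : κ (G.src x.edge) ≤ x.pos := by
    rw [← hsrc]
    have := dist_point_le hx (zero_mem x.edge)
    rwa [point_edge_pos, sub_zero, abs_of_nonneg hx.1] at this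
  have htx : κ (G.tgt x.edge) ≤ G.len x.edge - x.pos := by
    rw [← htgt]
    have := dist_point_le hx (len_mem x.edge)
    rwa [point_edge_pos, abs_sub_comm, abs_of_nonneg (by linarith [hx.2])] at this
  -- If some represented vertex fails `R`, then every constraint leading from `x` or from a vertex
  -- with `R` to one without is strict, since otherwise `extend` would apply. There are finitely
  -- many, so the distance potential can be raised by some `δ > 0` off `R` and stay admissible; it
  -- would then exceed the distance it bounds from below.
  have hR : ∀ (p : G.Point) (a : G.V), p.IsAt a → R a := by
    intro p a hp
    by_contra hRa
    have h1 : ∀ e, R (G.src e) → ¬ R (G.tgt e) → κ (G.tgt e) < κ (G.src e) + G.len e := by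
      intro e h h'
      refine lt_of_le_of_ne (by linarith [(abs_le.1 (hlen e)).1]) fun heq => h' ?_
      obtain ⟨γ, σ, hγ, hγ'⟩ := hs1 e h _ (len_mem e) (by rw [htgt, heq])
      rw [← heq] at hγ hγ'
      exact ⟨γ, σ, hγ, by rw [hγ']; exact isAt_tgt e⟩
    have h2 : ∀ e, R (G.tgt e) → ¬ R (G.src e) → κ (G.src e) < κ (G.tgt e) + G.len e := by
      intro e h h'
      refine lt_of_le_of_ne (by linarith [(abs_le.1 (hlen e)).2]) fun heq => h' ?_
      obtain ⟨γ, σ, hγ, hγ'⟩ := hs2 e h _ (zero_mem e) (by rw [hsrc, heq, sub_zero])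
      rw [sub_zero, ← heq] at hγ hγ'
      exact ⟨γ, σ, hγ, by rw [hγ']; exact isAt_src e⟩
    have h3 : ¬ R (G.src x.edge) → κ (G.src x.edge) < x.pos := by
      intro h'
      refine lt_of_le_of_ne hsx fun heq => h' ?_
      have h4 : |0 - x.pos| = κ (G.src x.edge) := by
        rw [zero_sub, abs_neg, abs_of_nonneg hx.1, heq]
      obtain ⟨γ, σ, hγ, hγ'⟩ := hs3 0 (zero_mem _) (by rw [hsrc, h4])
      rw [h4] at hγ hγ'
      exact ⟨γ, σ, hγ, by rw [hγ']; exact isAt_src _⟩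
    have h4 : ¬ R (G.tgt x.edge) → κ (G.tgt x.edge) < G.len x.edge - x.pos := by
      intro h'
      refine lt_of_le_of_ne htx fun heq => h' ?_
      have h4 : |G.len x.edge - x.pos| = κ (G.tgt x.edge) := by
        rw [abs_of_nonneg (by linarith [hx.2]), heq]
      obtain ⟨γ, σ, hγ, hγ'⟩ := hs3 _ (len_mem _) (by rw [htgt, h4])
      rw [h4] at hγ hγ'
      exact ⟨γ, σ, hγ, by rw [hγ']; exact isAt_tgt _⟩
    have hev : ∀ᶠ δ in nhdsWithin (0 : ℝ) (Set.Ioi 0), 0 < δ ∧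
        (∀ e, (R (G.src e) → ¬ R (G.tgt e) → κ (G.tgt e) + δ ≤ κ (G.src e) + G.len e) ∧
          (R (G.tgt e) → ¬ R (G.src e) → κ (G.src e) + δ ≤ κ (G.tgt e) + G.len e)) ∧
        (¬ R (G.src x.edge) → κ (G.src x.edge) + δ ≤ x.pos) ∧
        (¬ R (G.tgt x.edge) → κ (G.tgt x.edge) + δ ≤ G.len x.edge - x.pos) := by
      refine eventually_mem_nhdsWithin.and ((Filter.eventually_all.2 fun e => .and ?_ ?_).and
        (.and ?_ ?_))
      · simp only [Filter.eventually_imp_distrib_left]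
        exact fun h h' => eventually_add_le (h1 e h h')
      · simp only [Filter.eventually_imp_distrib_left]
        exact fun h h' => eventually_add_le (h2 e h h')
      · simp only [Filter.eventually_imp_distrib_left]
        exact fun h => eventually_add_le (h3 h)
      · simp only [Filter.eventually_imp_distrib_left]
        exact fun h => eventually_add_le (h4 h)
    obtain ⟨δ, hδ, hδe, hδs, hδt⟩ := hev.exists
    classical
    let κ' : G.V → ℝ := fun a => if R a then κ a else κ a + δ
    have hpos : ∀ a, R a → κ' a = κ a := fun a h => if_pos h
    have hneg : ∀ a, ¬ R a → κ' a = κ a + δ := fun a h => if_neg h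
    have hκ'e : ∀ e, |κ' (G.src e) - κ' (G.tgt e)| ≤ G.len e := by
      intro e
      have h5 := abs_le.1 (hlen e)
      have h6 := hδe e
      rw [abs_le]
      by_cases hs : R (G.src e) <;> by_cases ht : R (G.tgt e)
      · rw [hpos _ hs, hpos _ ht]
        exact h5
      · rw [hpos _ hs, hneg _ ht]
        have := h6.1 hs ht
        constructor <;> linarith
      · rw [hneg _ hs, hpos _ ht]
        have := h6.2 ht hs
        constructor <;> linarith
      · rw [hneg _ hs, hneg _ ht]
        constructor <;> linarith
    have hκ's : κ' (G.src x.edge) ≤ x.pos := by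
      by_cases h : R (G.src x.edge)
      · rwa [hpos _ h]
      · rw [hneg _ h]
        exact hδs h
    have hκ't : κ' (G.tgt x.edge) ≤ G.len x.edge - x.pos := by
      by_cases h : R (G.tgt x.edge)
      · rwa [hpos _ h]
      · rw [hneg _ h]
        exact hδt h
    have h5 := interpFrom_le_dist κ' x hκ'e hκ's hκ't p
    rw [interpFrom_isAt κ' x hκ'e hκ's hκ't hp, hneg a hRa, hκ p a hp] at h5
    linarith
  have hy := y.pos_mem
  have hd := dist_eq_interpFrom hκ y
  have hmin : G.dist x y = interp κ y →
      ∃ γ σ, IsGeodesic x (G.dist x y) γ σ ∧ γ (G.dist x y) = (y.edge, y.pos) := by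
    intro h
    obtain h' | h' := min_choice (κ (G.src y.edge) + y.pos)
      (κ (G.tgt y.edge) + (G.len y.edge - y.pos))
    · rw [interp, h'] at h
      rw [h]
      exact hs1 _ (hR _ _ (isAt_src _)) _ hy (by rw [point_edge_pos, h])
    · rw [interp, h'] at h
      rw [h]
      exact hs2 _ (hR _ _ (isAt_tgt _)) _ hy (by rw [point_edge_pos, h])
  unfold interpFrom at hd
  split_ifs at hd with he
  · obtain h' | h' := min_choice |y.pos - x.pos| (interp κ y)
    · rw [h'] at hd
      rw [hd, ← he]
      refine hs3 _ (by rwa [he]) ?_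
      rw [he, point_edge_pos, hd]
    · exact hmin (hd.trans h')
  · exact hmin hd

/-! ### Diameter and total length -/

lemma dist_le_totalLength (x y : G.Point) : G.dist x y ≤ G.totalLength := by
  obtain ⟨γ, σ, h, -⟩ := exists_isGeodesic x y
  -- A shortest path covers no length twice, so integrating 1 along it gives at most the total
  -- length.
  have := h.integral_le (dist_nonneg x y) (F := fun _ => 1) (integrable_const _)
    (.of_forall fun _ => zero_le_one)
  rw [integral_vol (integrable_const _)] at this
  simpa [totalLength] using this

lemma bddAbove_dist : BddAbove {d : ℝ | ∃ p q : G.Point, d = G.dist p q} :=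
  ⟨G.totalLength, by rintro _ ⟨p, q, rfl⟩; exact dist_le_totalLength p q⟩

lemma dist_le_diam (x y : G.Point) : G.dist x y ≤ G.diam :=
  le_csSup bddAbove_dist ⟨x, y, rfl⟩

lemma nonempty_dist : {d : ℝ | ∃ p q : G.Point, d = G.dist p q}.Nonempty :=
  let e := Classical.arbitrary G.E
  ⟨_, G.point e 0, G.point e 0, rfl⟩

lemma diam_le_totalLength : G.diam ≤ G.totalLength :=
  csSup_le nonempty_dist (by rintro _ ⟨p, q, rfl⟩; exact dist_le_totalLength p q)

lemma diam_pos : 0 < G.diam := by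
  let e := Classical.arbitrary G.E
  have hl := G.len_pos e
  have hm : G.len e / 2 ∈ Set.Icc 0 (G.len e) := ⟨by linarith, by linarith⟩
  -- The zero potential: even with all vertices at distance 0, the midpoint of an edge is half an
  -- edge away from its start.
  have h := interpFrom_le_dist (fun _ => 0) (G.point e 0) (by simp [fun e => (G.len_pos e).le])
    (by simp [point_pos (zero_mem e)]) (by simp [point_pos (zero_mem e), hl.le])
    (G.point e (G.len e / 2))
  refine lt_of_lt_of_le ?_ (h.trans (dist_le_diam _ _))
  unfold interpFrom interp
  rw [if_pos (show (G.point e 0).edge = (G.point e (G.len e / 2)).edge from rfl)]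
  simp only [point_pos hm, point_pos (zero_mem e), point_edge, sub_zero, zero_add]
  refine lt_min (abs_pos.2 (by linarith)) (lt_min ?_ ?_) <;> linarith

/-- The diameter is attained. -/
lemma exists_dist_eq_diam : ∃ x y : G.Point, G.dist x y = G.diam := by
  classical
  have hcont : ∀ e e' : G.E, Continuous fun z : ℝ × ℝ =>
      G.dist (G.point e z.1) (G.point e' z.2) := by
    intro e e'
    refine (LipschitzWith.of_dist_le_mul (K := 2) fun s t => ?_).continuous
    have h : ∀ (e : G.E) (s t : ℝ), G.dist (G.point e s) (G.point e t) ≤ |s - t| := by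
      intro e s t
      refine (dist_le_of_edge_eq
        (show (G.point e s).edge = (G.point e t).edge from rfl)).trans ?_
      exact Set.abs_projIcc_sub_projIcc (G.len_pos e).le
    have h1 := h e s.1 t.1
    have h2 := h e' s.2 t.2
    have h3 := abs_dist_sub_dist_le (G.point e s.1) (G.point e' s.2) (G.point e' t.2)
    have h4 := abs_dist_sub_dist_le (G.point e' t.2) (G.point e s.1) (G.point e t.1)
    rw [dist_comm _ (G.point e s.1), dist_comm _ (G.point e t.1)] at h4
    have h5 : |s.1 - t.1| ≤ Dist.dist s t := by
      rw [← Real.dist_eq]; exact le_max_left _ _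
    have h6 : |s.2 - t.2| ≤ Dist.dist s t := by
      rw [← Real.dist_eq]; exact le_max_right _ _
    rw [Real.dist_eq]
    refine (abs_sub_le _ (G.dist (G.point e s.1) (G.point e' t.2)) _).trans ?_
    rw [NNReal.coe_ofNat]
    linarith
  have hmax : ∀ i : G.E × G.E, ∃ z : ℝ × ℝ, ∀ s ∈ Set.Icc 0 (G.len i.1),
      ∀ t ∈ Set.Icc 0 (G.len i.2), G.dist (G.point i.1 s) (G.point i.2 t) ≤
        G.dist (G.point i.1 z.1) (G.point i.2 z.2) := by
    intro i
    obtain ⟨z, -, hz⟩ := (isCompact_Icc.prod isCompact_Icc).exists_isMaxOn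
      (s := Set.Icc 0 (G.len i.1) ×ˢ Set.Icc 0 (G.len i.2)) ⟨(0, 0), zero_mem _, zero_mem _⟩
      (hcont i.1 i.2).continuousOn
    exact ⟨z, fun s hs t ht => hz (show (s, t) ∈ _ from ⟨hs, ht⟩)⟩
  choose z hz using hmax
  obtain ⟨i, hi⟩ := Finite.exists_max fun i : G.E × G.E =>
    G.dist (G.point i.1 (z i).1) (G.point i.2 (z i).2)
  refine ⟨_, _, le_antisymm (dist_le_diam (G.point i.1 (z i).1) (G.point i.2 (z i).2))
    (csSup_le nonempty_dist ?_)⟩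
  rintro _ ⟨p, q, rfl⟩
  have := hz (p.edge, q.edge) _ p.pos_mem _ q.pos_mem
  simp only [point_edge_pos] at this
  exact this.trans (hi (p.edge, q.edge))

/-- A graph whose diameter is its total length is a path. -/
theorem isPath_of_diam_eq (h : G.diam = G.totalLength) : G.IsPath := by
  obtain ⟨x, y, hxy⟩ := exists_dist_eq_diam (G := G)
  obtain ⟨γ, σ, hγ, -⟩ := exists_isGeodesic x y
  have hL : G.dist x y = G.totalLength := hxy.trans h
  rw [hL] at hγ
  have hL0 : 0 ≤ G.totalLength := hL ▸ dist_nonneg x y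
  let c : ℝ → G.Point := fun s => G.point (γ s).1 (γ s).2
  have hrange : ∀ p : G.Point, G.dist x p ∈ Set.Icc 0 G.totalLength := fun p =>
    ⟨dist_nonneg _ _, dist_le_totalLength _ _⟩
  have hcover : ∀ p : G.Point, G.dist (c (G.dist x p)) p = 0 := by
    intro p
    by_contra hne
    have hpos : 0 < G.dist (c (G.dist x p)) p := lt_of_le_of_ne (dist_nonneg _ _) (Ne.symm hne)
    set η := G.dist (c (G.dist x p)) p with hη
    -- `F` equals `η / 2` along a path of full length, so its integral is at least that of the
    -- constant `η / 2`; but `F ≤ η / 2` everywhere and `F` is smaller near `p`.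
    let F : G.E × ℝ → ℝ := fun z => min (distFrom p z) (η / 2)
    have hFc : ∀ e, Continuous fun t => F (e, t) := fun e =>
      (continuous_distFrom p e).min continuous_const
    -- Both `|G.dist x p - s|` and, through it, the distance from `c (G.dist x p)` to `c s` are at
    -- most `G.dist p (c s)`; hence `η ≤ 2 * G.dist p (c s)`.
    have hfar : ∀ s ∈ Set.Icc 0 G.totalLength, F (γ s) = η / 2 := by
      intro s hs
      refine min_eq_right ?_
      have h1 := abs_dist_sub_dist_le x p (c s)
      rw [show G.dist x (c s) = s from hγ.distFrom_eq s hs] at h1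
      have h2 : G.dist (c (G.dist x p)) (c s) ≤ |G.dist x p - s| :=
        hγ.dist_le _ (hrange p) s hs
      have h3 := dist_triangle (c (G.dist x p)) (c s) p
      rw [dist_comm (c s) p] at h3
      change η / 2 ≤ G.dist p (c s)
      linarith
    have hint : Integrable F G.vol := integrable_vol.2 fun e =>
      (hFc e).continuousOn.integrableOn_Icc
    have h1 := hγ.integral_le hL0 hint (.of_forall fun z =>
      le_min (dist_nonneg _ _) (half_pos hpos).le)
    have h2 : ∫ s in 0..G.totalLength, F (γ s) = ∫ s in 0..G.totalLength, η / 2 := by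
      refine intervalIntegral.integral_congr fun s hs => ?_
      rw [Set.uIcc_of_le hL0] at hs
      exact hfar s hs
    have hconst : ∀ e, ∫ t in 0..G.len e, η / 2 = G.len e * (η / 2) := fun e => by
      rw [intervalIntegral.integral_const, sub_zero, smul_eq_mul]
    rw [h2, integral_vol hint] at h1
    simp only [intervalIntegral.integral_const, sub_zero, smul_eq_mul] at h1
    have h3 : ∀ e, ∫ t in 0..G.len e, F (e, t) ≤ G.len e * (η / 2) := by
      intro e
      rw [← hconst]
      exact intervalIntegral.integral_mono_on (G.len_pos e).le
        ((hFc e).intervalIntegrable _ _) intervalIntegrable_const fun t _ => min_le_right _ _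
    have h4 : ∫ t in 0..G.len p.edge, F (p.edge, t) < G.len p.edge * (η / 2) := by
      rw [← hconst]
      refine intervalIntegral.integral_lt_integral_of_continuousOn_of_le_of_exists_lt
        (G.len_pos _) (hFc _).continuousOn continuousOn_const (fun t _ => min_le_right _ _)
        ⟨p.pos, p.pos_mem, min_lt_of_left_lt ?_⟩
      simp only [distFrom, point_edge_pos, dist_self]
      exact half_pos hpos
    have h5 := Finset.sum_lt_sum (fun e _ => h3 e) ⟨p.edge, Finset.mem_univ _, h4⟩
    rw [← Finset.sum_mul] at h5
    exact absurd h1 (not_le.2 h5)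
  have hle : ∀ p q : G.Point, G.dist p q ≤ |G.dist x p - G.dist x q| := by
    intro p q
    have h1 := dist_triangle p (c (G.dist x p)) q
    have h2 := dist_triangle (c (G.dist x p)) (c (G.dist x q)) q
    have h3 : G.dist (c (G.dist x p)) (c (G.dist x q)) ≤ |G.dist x p - G.dist x q| :=
      hγ.dist_le _ (hrange p) _ (hrange q)
    rw [dist_comm p (c _), hcover p] at h1
    rw [hcover q] at h2
    linarith
  refine ⟨G.totalLength, G.dist x, ?_, fun p q =>
    le_antisymm (abs_dist_sub_dist_le x p q) (hle p q)⟩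
  ext s
  constructor
  · rintro ⟨p, rfl⟩
    exact hrange p
  · exact fun hs => ⟨c s, hγ.distFrom_eq s hs⟩

end MetricGraph

/-! ### Intervals with point masses at the ends -/

/-- Picone's inequality with the comparison function `sin (k x + ε)`. -/
lemma picone_inequality {d k ε : ℝ} {f g : ℝ → ℝ} (hd : 0 ≤ d) (hk : 0 < k) (hε : 0 < ε)
    (hkd : k * d + ε < Real.pi) (hg : IntervalIntegrable g volume 0 d)
    (hg2 : IntervalIntegrable (fun x => g x ^ 2) volume 0 d)
    (hf : ∀ x ∈ Set.Icc 0 d, f x = ∫ t in 0..x, g t) :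
    k * Real.tan (Real.pi / 2 - ε - k * d) * f d ^ 2 + k ^ 2 * ∫ x in 0..d, f x ^ 2 ≤
      ∫ x in 0..d, g x ^ 2 := by
  set F : ℝ → ℝ := fun x => ∫ t in 0..x, g t with hF
  -- `W` is the logarithmic derivative of `sin (k x + ε)`, a cotangent, and solves the Riccati
  -- equation W' = -k² - W². The shift `ε` avoids its pole at 0.
  set W : ℝ → ℝ := fun x => k * Real.tan (Real.pi / 2 - ε - k * x) with hW
  have hFac : AbsolutelyContinuousOnInterval F 0 d :=
    hg.absolutelyContinuousOnInterval_intervalIntegral Set.left_mem_uIcc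
  have hcos : ∀ x ∈ Set.Icc 0 d, Real.cos (Real.pi / 2 - ε - k * x) ≠ 0 := by
    intro x hx
    have h1 : k * x ≤ k * d := mul_le_mul_of_nonneg_left hx.2 hk.le
    have h2 : 0 ≤ k * x := mul_nonneg hk.le hx.1
    rw [show Real.pi / 2 - ε - k * x = Real.pi / 2 - (ε + k * x) by ring,
      Real.cos_pi_div_two_sub]
    exact (Real.sin_pos_of_pos_of_lt_pi (by linarith) (by linarith)).ne'
  have hWd : ∀ x ∈ Set.Icc 0 d, HasDerivAt W (-k ^ 2 - W x ^ 2) x := by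
    intro x hx
    have h1 : HasDerivAt (fun x : ℝ => Real.pi / 2 - ε - k * x) (-k) x := by
      simpa using ((hasDerivAt_id x).const_mul k).const_sub (Real.pi / 2 - ε)
    have h2 := ((Real.hasDerivAt_tan (hcos x hx)).comp x h1).const_mul k
    convert! h2 using 1
    have h3 := Real.one_add_tan_sq_mul_cos_sq_eq_one (hcos x hx)
    have h4 := hcos x hx
    simp only [hW]
    generalize Real.pi / 2 - ε - k * x = θ at h3 h4 ⊢
    field_simp
    linear_combination -h3
  have hWc : ContinuousOn W (Set.Icc 0 d) := fun x hx => (hWd x hx).continuousAt.continuousWithinAt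
  have hWac : AbsolutelyContinuousOnInterval W 0 d := by
    refine ContDiffOn.absolutelyContinuousOnInterval fun x hx => ?_
    rw [Set.uIcc_of_le hd] at hx
    refine ContDiffAt.contDiffWithinAt (contDiffAt_const.mul ?_)
    exact ContDiffAt.comp (g := Real.tan) x (Real.contDiffAt_tan.2 (hcos x hx)) (by fun_prop)
  have hFc : ContinuousOn F (Set.uIcc 0 d) := hFac.continuousOn
  rw [← Set.uIcc_of_le hd] at hWc hWd
  have key := (hFac.mul hFac).integral_deriv_mul_eq_sub hWac
  have hcongr : ∫ x in 0..d, deriv (F * F) x * W x + (F * F) x * deriv W x =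
      ∫ x in 0..d, (2 * (F x * W x) * g x + F x ^ 2 * (-k ^ 2 - W x ^ 2)) := by
    refine intervalIntegral.integral_congr_ae ?_
    filter_upwards [hg.ae_hasDerivAt_integral] with x hx hx'
    have hx' := Set.uIoc_subset_uIcc hx'
    have h1 : HasDerivAt F (g x) x := hx hx' 0 Set.left_mem_uIcc
    rw [(h1.mul h1).deriv, (hWd x hx').deriv, Pi.mul_apply]
    ring
  have hi1 : IntervalIntegrable (fun x => 2 * (F x * W x) * g x + F x ^ 2 * (-k ^ 2 - W x ^ 2))
      volume 0 d :=
    (hg.continuousOn_mul (continuousOn_const.mul (hFc.mul hWc))).add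
      ((hFc.pow 2).mul (continuousOn_const.sub (hWc.pow 2))).intervalIntegrable
  have hi2 : IntervalIntegrable (fun x => k ^ 2 * F x ^ 2) volume 0 d :=
    (continuousOn_const.mul (hFc.pow 2)).intervalIntegrable
  -- Pointwise, (F²W)' = g² - k²F² - (g - WF)².
  have hle := intervalIntegral.integral_mono_on hd hi1 (hg2.sub hi2) fun x _ => by
    have := sq_nonneg (g x - W x * F x)
    nlinarith
  rw [intervalIntegral.integral_sub hg2 hi2, ← hcongr, key, intervalIntegral.integral_const_mul]
    at hle
  have hF0 : F 0 = 0 := intervalIntegral.integral_same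
  have hfd : f d = F d := hf d ⟨hd, le_rfl⟩
  have hff : ∫ x in 0..d, f x ^ 2 = ∫ x in 0..d, F x ^ 2 :=
    intervalIntegral.integral_congr fun x hx => by
      rw [Set.uIcc_of_le hd] at hx
      simp only [hf x hx, hF]
  rw [hfd, hff]
  simp only [Pi.mul_apply, hF0] at hle
  change W d * F d ^ 2 + _ ≤ _
  nlinarith

/-- The first eigenvalue of an interval with a Dirichlet end and a point mass `M` at the other. -/
lemma dirichlet_mass_bound {d k M : ℝ} {f g : ℝ → ℝ} (hd : 0 ≤ d) (hk : 0 < k) (hM : 0 ≤ M)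
    (hkd : k * d + Real.arctan (k * M) ≤ Real.pi / 2) (hg : IntervalIntegrable g volume 0 d)
    (hg2 : IntervalIntegrable (fun x => g x ^ 2) volume 0 d)
    (hf : ∀ x ∈ Set.Icc 0 d, f x = ∫ t in 0..x, g t) :
    k ^ 2 * ((∫ x in 0..d, f x ^ 2) + M * f d ^ 2) ≤ ∫ x in 0..d, g x ^ 2 := by
  -- The limit `ε → 0` below needs `k * d > 0`, where the cotangent is continuous.
  obtain rfl | hd' := hd.eq_or_lt
  · simp [hf 0 ⟨le_rfl, le_rfl⟩]
  have hpos : 0 < k * d := mul_pos hk hd'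
  have harc : 0 ≤ Real.arctan (k * M) := Real.arctan_nonneg.2 (by positivity)
  have hpi := Real.pi_pos
  -- The angle condition says exactly that the boundary term of Picone's inequality dominates that
  -- of the mass `M`.
  have htan : k * M ≤ Real.tan (Real.pi / 2 - k * d) := by
    rw [← Real.tan_arctan (k * M)]
    exact Real.strictMonoOn_tan.monotoneOn ⟨by linarith, by linarith⟩
      ⟨by linarith, by linarith⟩ (by linarith)
  have hcont : ContinuousAt (fun ε => k * Real.tan (Real.pi / 2 - ε - k * d) * f d ^ 2 +
      k ^ 2 * ∫ x in 0..d, f x ^ 2) 0 := by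
    have h1 : ContinuousAt (fun ε => Real.tan (Real.pi / 2 - ε - k * d)) 0 := by
      refine ContinuousAt.comp (g := Real.tan) (Real.continuousAt_tan.2 ?_)
        (Continuous.continuousAt (by fun_prop))
      rw [sub_zero, Real.cos_pi_div_two_sub]
      exact (Real.sin_pos_of_pos_of_lt_pi hpos (by linarith)).ne'
    fun_prop
  have hev : ∀ᶠ ε in nhdsWithin (0 : ℝ) (Set.Ioi 0),
      k * Real.tan (Real.pi / 2 - ε - k * d) * f d ^ 2 + k ^ 2 * ∫ x in 0..d, f x ^ 2 ≤
        ∫ x in 0..d, g x ^ 2 := by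
    filter_upwards [Ioo_mem_nhdsGT (show (0 : ℝ) < Real.pi / 2 by linarith)] with ε hε
    exact picone_inequality hd hk hε.1 (by linarith [hε.2]) hg hg2 hf
  have hle := le_of_tendsto (hcont.tendsto.mono_left nhdsWithin_le_nhds) hev
  rw [sub_zero] at hle
  have h2 : k * (k * M) * f d ^ 2 ≤ k * Real.tan (Real.pi / 2 - k * d) * f d ^ 2 := by gcongr
  calc _ = k * (k * M) * f d ^ 2 + k ^ 2 * ∫ x in 0..d, f x ^ 2 := by ring
    _ ≤ _ := by linarith

/-- An interval with point masses at its ends: a lower bound for the spectral gap. -/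
lemma interval_mass_bound {p k Ma Mb : ℝ} {f g : ℝ → ℝ} (hp : 0 ≤ p) (hk : 0 < k) (hMa : 0 ≤ Ma)
    (hMb : 0 ≤ Mb) (hkp : k * p + Real.arctan (k * Ma) + Real.arctan (k * Mb) ≤ Real.pi)
    (hg : IntervalIntegrable g volume 0 p)
    (hg2 : IntervalIntegrable (fun x => g x ^ 2) volume 0 p)
    (hf : ∀ x ∈ Set.Icc 0 p, f x = f 0 + ∫ t in 0..x, g t) :
    ∃ c, k ^ 2 * ((∫ x in 0..p, (f x - c) ^ 2) + Ma * (f 0 - c) ^ 2 + Mb * (f p - c) ^ 2) ≤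
      ∫ x in 0..p, g x ^ 2 := by
  -- The cut plays the role of the node of the first eigenfunction: the left part gets the angle π/2
  -- with its mass, leaving at most π/2 for the right. If the left part cannot use up π/2, then `z =
  -- p` and the right part is trivial.
  set z := min p ((Real.pi / 2 - Real.arctan (k * Ma)) / k) with hz
  have hz1 : k * z + Real.arctan (k * Ma) ≤ Real.pi / 2 := by
    have : z ≤ (Real.pi / 2 - Real.arctan (k * Ma)) / k := min_le_right _ _
    rw [le_div_iff₀ hk] at this
    linarith
  have hz2 : k * (p - z) + Real.arctan (k * Mb) ≤ Real.pi / 2 := by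
    rw [hz]
    obtain h | h := min_choice p ((Real.pi / 2 - Real.arctan (k * Ma)) / k)
    · rw [h, sub_self, mul_zero, zero_add]
      exact (Real.arctan_lt_pi_div_two _).le
    · rw [h, mul_sub, mul_div_cancel₀ _ hk.ne']
      linarith
  have hzp : z ≤ p := min_le_left _ _
  have hz0 : 0 ≤ z := le_min hp
    (div_nonneg (by linarith [Real.arctan_lt_pi_div_two (k * Ma)]) hk.le)
  have hsub1 : Set.uIcc 0 z ⊆ Set.uIcc 0 p := by
    rw [Set.uIcc_of_le hz0, Set.uIcc_of_le hp]
    exact Set.Icc_subset_Icc le_rfl hzp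
  have hsub2 : Set.uIcc z p ⊆ Set.uIcc 0 p := by
    rw [Set.uIcc_of_le hzp, Set.uIcc_of_le hp]
    exact Set.Icc_subset_Icc hz0 le_rfl
  have hfz : ∀ x ∈ Set.Icc 0 p, f x - f z = ∫ t in z..x, g t := by
    intro x hx
    rw [hf x hx, hf z ⟨hz0, hzp⟩, add_sub_add_left_eq_sub]
    refine intervalIntegral.integral_interval_sub_left (hg.mono_set ?_) (hg.mono_set hsub1)
    rw [Set.uIcc_of_le hx.1, Set.uIcc_of_le hp]
    exact Set.Icc_subset_Icc le_rfl hx.2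
  have hfc : ContinuousOn f (Set.uIcc 0 p) := by
    have h1 := (hg.absolutelyContinuousOnInterval_intervalIntegral
      (Set.left_mem_uIcc (a := (0 : ℝ)) (b := p))).continuousOn
    refine (continuousOn_const (c := f 0) |>.add h1).congr fun x hx => hf x ?_
    rwa [Set.uIcc_of_le hp] at hx
  have hR := dirichlet_mass_bound (f := fun x => f (x + z) - f z) (g := fun x => g (x + z))
    (sub_nonneg.2 hzp) hk hMb hz2
    (by simpa using (hg.mono_set hsub2).comp_add_right z)
    (by simpa using (hg2.mono_set hsub2).comp_add_right z) (fun x hx => by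
      rw [intervalIntegral.integral_comp_add_right, zero_add]
      exact hfz _ ⟨by linarith [hx.1], by linarith [hx.2]⟩)
  have hL := dirichlet_mass_bound (f := fun x => f (z - x) - f z) (g := fun x => -g (z - x))
    hz0 hk hMa hz1
    (by simpa [Pi.neg_def] using ((hg.mono_set hsub1).comp_sub_left z).symm.neg)
    (by simpa using ((hg2.mono_set hsub1).comp_sub_left z).symm) (fun x hx => by
      rw [intervalIntegral.integral_neg, intervalIntegral.integral_comp_sub_left, sub_zero,
        ← intervalIntegral.integral_symm]
      exact hfz _ ⟨by linarith [hx.2], by linarith [hx.1]⟩)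
  refine ⟨f z, ?_⟩
  rw [intervalIntegral.integral_comp_add_right (fun x => (f x - f z) ^ 2),
    intervalIntegral.integral_comp_add_right (fun x => g x ^ 2), zero_add, sub_add_cancel] at hR
  simp only [neg_sq] at hL
  rw [intervalIntegral.integral_comp_sub_left (fun x => (f x - f z) ^ 2),
    intervalIntegral.integral_comp_sub_left (fun x => g x ^ 2), sub_zero, sub_self] at hL
  have hfi : IntervalIntegrable (fun x => (f x - f z) ^ 2) volume 0 p :=
    ((hfc.sub continuousOn_const).pow 2).intervalIntegrable
  rw [← intervalIntegral.integral_add_adjacent_intervals (hfi.mono_set hsub1)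
    (hfi.mono_set hsub2), ← intervalIntegral.integral_add_adjacent_intervals
    (hg2.mono_set hsub1) (hg2.mono_set hsub2)]
  linarith

/-- Concavity of `arctan` on `[0, ∞)`: for a given total mass, equal end masses are the worst case.
-/
lemma arctan_add_arctan_le {x y : ℝ} (hx : 0 ≤ x) (hy : 0 ≤ y) :
    Real.arctan x + Real.arctan y ≤ 2 * Real.arctan ((x + y) / 2) := by
  have hc : ConcaveOn ℝ (Set.Ici 0) Real.arctan := by
    refine AntitoneOn.concaveOn_of_deriv (convex_Ici 0) Real.continuous_arctan.continuousOn
      Real.differentiable_arctan.differentiableOn ?_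
    rw [interior_Ici]
    intro a ha b hb hab
    rw [Set.mem_Ioi] at ha
    simp only [Real.deriv_arctan]
    gcongr
  have := hc.2 hx hy (show (0 : ℝ) ≤ 1 / 2 by norm_num) (show (0 : ℝ) ≤ 1 / 2 by norm_num)
    (by norm_num)
  simp only [smul_eq_mul] at this
  rw [show (x + y) / 2 = 1 / 2 * x + 1 / 2 * y by ring]
  linarith

/-- Used to see that lengthening the interval at the expense of its end masses does not decrease the
total angle. -/
lemma arctan_sub_arctan_le {x y : ℝ} (h : x ≤ y) : Real.arctan y - Real.arctan x ≤ y - x := by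
  have := (convex_univ (𝕜 := ℝ) (E := ℝ)).image_sub_le_mul_sub_of_deriv_le (C := 1)
    (f := Real.arctan) Real.continuous_arctan.continuousOn
    Real.differentiable_arctan.differentiableOn (fun x _ => by
      rw [Real.deriv_arctan, div_le_one (by positivity)]
      nlinarith [sq_nonneg x]) x trivial y trivial h
  linarith

/-- The equation is the eigenvalue condition for `sin (k (x - D / 2))` on an interval of length `D`
with end masses `(L - D) / 2`. Its left side is 0 at `k = 0` and at least π at `k = π / D`. -/
lemma exists_frequency {D L : ℝ} (hD : 0 < D) (hDL : D ≤ L) :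
    ∃ k, 0 < k ∧ k * D + 2 * Real.arctan (k * ((L - D) / 2)) = Real.pi := by
  have hc : Continuous fun k => k * D + 2 * Real.arctan (k * ((L - D) / 2)) := by
    have := Real.continuous_arctan
    fun_prop
  have hpi := Real.pi_pos
  have h1 : Real.pi ∈ Set.Icc ((fun k => k * D + 2 * Real.arctan (k * ((L - D) / 2))) 0)
      ((fun k => k * D + 2 * Real.arctan (k * ((L - D) / 2))) (Real.pi / D)) := by
    refine ⟨by simpa using hpi.le, ?_⟩
    have : 0 ≤ Real.arctan (Real.pi / D * ((L - D) / 2)) :=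
      Real.arctan_nonneg.2 (mul_nonneg (by positivity) (by linarith))
    simp only [div_mul_cancel₀ _ hD.ne']
    linarith
  obtain ⟨k, hk, hk'⟩ := intermediate_value_Icc (by positivity) hc.continuousOn h1
  refine ⟨k, lt_of_le_of_ne hk.1 ?_, hk'⟩
  rintro rfl
  simp at hk'
  exact hpi.ne hk'

/-- The comparison of a graph with an interval with point masses, in terms of the moments of the
part of the graph that does not belong to the interval. -/
lemma rayleigh_bound {D L p k N E a b : ℝ} {f g : ℝ → ℝ} (hp : 0 ≤ p) (hpD : p ≤ D)
    (hDL : D ≤ L) (hk : 0 < k) (hkD : k * D + 2 * Real.arctan (k * ((L - D) / 2)) = Real.pi)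
    (hg : IntervalIntegrable g volume 0 p)
    (hg2 : IntervalIntegrable (fun x => g x ^ 2) volume 0 p)
    (hf : ∀ x ∈ Set.Icc 0 p, f x = f 0 + ∫ t in 0..x, g t) (h0 : f 0 = a) (hfp : f p = b)
    (hab : a < b) (hE : ∫ x in 0..p, g x ^ 2 ≤ E)
    (ha : ∫ x in 0..p, (f x - a) ≤ -(a * L)) (hb : ∫ x in 0..p, (b - f x) ≤ b * L)
    (hN : ∫ x in 0..p, (b - f x) * (f x - a) ≤ -N - a * b * L) : k ^ 2 * N ≤ E := by
  have hfc : ContinuousOn f (Set.uIcc 0 p) := by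
    have h1 := (hg.absolutelyContinuousOnInterval_intervalIntegral
      (Set.left_mem_uIcc (a := (0 : ℝ)) (b := p))).continuousOn
    refine (continuousOn_const (c := f 0) |>.add h1).congr fun x hx => hf x ?_
    rwa [Set.uIcc_of_le hp] at hx
  have hfi : IntervalIntegrable f volume 0 p := hfc.intervalIntegrable
  have hfi2 : IntervalIntegrable (fun x => f x ^ 2) volume 0 p := (hfc.pow 2).intervalIntegrable
  set I1 := ∫ x in 0..p, f x with hI1
  set I2 := ∫ x in 0..p, f x ^ 2 with hI2
  have hquad : ∀ r s t : ℝ, ∫ x in 0..p, (r * f x ^ 2 + s * f x + t) = r * I2 + s * I1 + t * p := by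
    intro r s t
    rw [intervalIntegral.integral_add ((hfi2.const_mul r).add (hfi.const_mul s))
      intervalIntegrable_const, intervalIntegral.integral_add (hfi2.const_mul r) (hfi.const_mul s),
      intervalIntegral.integral_const_mul, intervalIntegral.integral_const_mul,
      intervalIntegral.integral_const, sub_zero, smul_eq_mul, mul_comm p t]
  have ha' : I1 - a * p ≤ -(a * L) := by
    have := hquad 0 1 (-a)
    refine le_trans (le_of_eq ?_) ha
    rw [show (fun x => f x - a) = fun x => 0 * f x ^ 2 + 1 * f x + -a by ext x; ring, this]
    ring
  have hb' : b * p - I1 ≤ b * L := by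
    have := hquad 0 (-1) b
    refine le_trans (le_of_eq ?_) hb
    rw [show (fun x => b - f x) = fun x => 0 * f x ^ 2 + -1 * f x + b by ext x; ring, this]
    ring
  have hN' : -I2 + (a + b) * I1 - a * b * p ≤ -N - a * b * L := by
    have := hquad (-1) (a + b) (-(a * b))
    refine le_trans (le_of_eq ?_) hN
    rw [show (fun x => (b - f x) * (f x - a)) =
      fun x => -1 * f x ^ 2 + (a + b) * f x + -(a * b) by ext x; ring, this]
    ring
  have hba : 0 < b - a := sub_pos.2 hab
  -- The masses solve Ma + Mb = L - p and a Ma + b Mb = -I1: they have the mass and the first moment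
  -- of the discarded part, the total mean being zero. `hb` and `ha` make them nonnegative.
  set Ma := (b * (L - p) + I1) / (b - a) with hMa
  set Mb := (-I1 - a * (L - p)) / (b - a) with hMb
  have hMa0 : 0 ≤ Ma := div_nonneg (by linarith) hba.le
  have hMb0 : 0 ≤ Mb := div_nonneg (by linarith) hba.le
  have e1 : Ma * (b - a) = b * (L - p) + I1 := div_mul_cancel₀ _ hba.ne'
  have e2 : Mb * (b - a) = -I1 - a * (L - p) := div_mul_cancel₀ _ hba.ne'
  have hsum : Ma + Mb = L - p := by
    refine mul_right_cancel₀ hba.ne' ?_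
    rw [add_mul, e1, e2]
    ring
  have hmom : a * Ma + b * Mb = -I1 := by
    refine mul_right_cancel₀ hba.ne' ?_
    rw [add_mul, mul_assoc, mul_assoc, e1, e2]
    ring
  have hmom2 : a ^ 2 * Ma + b ^ 2 * Mb = -(a + b) * I1 - a * b * (L - p) := by
    linear_combination (a + b) * hmom - a * b * hsum
  have hkp : k * p + Real.arctan (k * Ma) + Real.arctan (k * Mb) ≤ Real.pi := by
    have h1 := arctan_add_arctan_le (mul_nonneg hk.le hMa0) (mul_nonneg hk.le hMb0)
    rw [← mul_add, hsum] at h1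
    have h2 : k * ((L - D) / 2) ≤ k * (L - p) / 2 := by
      have : k * p ≤ k * D := mul_le_mul_of_nonneg_left hpD hk.le
      linarith
    have h3 := arctan_sub_arctan_le h2
    linarith
  obtain ⟨c, hc⟩ := interval_mass_bound hp hk hMa0 hMb0 hkp hg hg2 hf
  have h4 : ∫ x in 0..p, (f x - c) ^ 2 = I2 - 2 * c * I1 + c ^ 2 * p := by
    have := hquad 1 (-(2 * c)) (c ^ 2)
    rw [show (fun x => (f x - c) ^ 2) =
      fun x => 1 * f x ^ 2 + -(2 * c) * f x + c ^ 2 by ext x; ring, this]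
    ring
  rw [h0, hfp, h4] at hc
  refine le_trans (mul_le_mul_of_nonneg_left ?_ (sq_nonneg k)) (hc.trans hE)
  -- The weighted mean is zero, so shifting by `c` only adds `c ^ 2 * L`; the remaining terms are at
  -- least `N` by `hN'`.
  have h5 : I2 - 2 * c * I1 + c ^ 2 * p + Ma * (a - c) ^ 2 + Mb * (b - c) ^ 2 =
      I2 - (a + b) * I1 - a * b * (L - p) + c ^ 2 * L := by
    linear_combination hmom2 - 2 * c * hmom + c ^ 2 * hsum
  rw [h5]
  have : 0 ≤ c ^ 2 * L := mul_nonneg (sq_nonneg c) (by linarith)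
  linarith

/-! ### The lower bound for the spectral gap of a graph -/

namespace MetricGraph

variable {G : MetricGraph.{u, v}}

lemma H1.continuousOn (w : G.H1) (e : G.E) : ContinuousOn (w.toFun e) (Set.Icc 0 (G.len e)) := by
  have h1 := ((w.intervalIntegrable_der (zero_mem e)
    (len_mem e)).absolutelyContinuousOnInterval_intervalIntegral Set.left_mem_uIcc).continuousOn
  rw [Set.uIcc_of_le (G.len_pos e).le] at h1
  exact (continuousOn_const (c := w.toFun e 0) |>.add h1).congr fun x hx => w.eq_integral e x hx

lemma H1.continuousOn_uIcc (w : G.H1) (e : G.E) :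
    ContinuousOn (w.toFun e) (Set.uIcc 0 (G.len e)) := by
  rw [Set.uIcc_of_le (G.len_pos e).le]
  exact w.continuousOn e

lemma H1.integrable_comp (w : G.H1) {φ : ℝ → ℝ} (hφ : Continuous φ) :
    Integrable (fun z => φ (w.toFun z.1 z.2)) G.vol :=
  integrable_vol.2 fun e => (hφ.comp_continuousOn (w.continuousOn e)).integrableOn_Icc

lemma H1.exists_min (w : G.H1) :
    ∃ x : G.Point, ∀ e, ∀ t ∈ Set.Icc 0 (G.len e), w.toFun x.edge x.pos ≤ w.toFun e t := by
  have h : ∀ e, ∃ s ∈ Set.Icc 0 (G.len e), ∀ t ∈ Set.Icc 0 (G.len e), w.toFun e s ≤ w.toFun e t :=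
    fun e => isCompact_Icc.exists_isMinOn ⟨0, zero_mem e⟩ (w.continuousOn e)
  choose s hs hs' using h
  obtain ⟨e, he⟩ := Finite.exists_min fun e => w.toFun e (s e)
  exact ⟨⟨e, s e, hs e⟩, fun e' t ht => (he e').trans (hs' e' t ht)⟩

lemma H1.exists_max (w : G.H1) :
    ∃ x : G.Point, ∀ e, ∀ t ∈ Set.Icc 0 (G.len e), w.toFun e t ≤ w.toFun x.edge x.pos := by
  have h : ∀ e, ∃ s ∈ Set.Icc 0 (G.len e), ∀ t ∈ Set.Icc 0 (G.len e), w.toFun e t ≤ w.toFun e s :=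
    fun e => isCompact_Icc.exists_isMaxOn ⟨0, zero_mem e⟩ (w.continuousOn e)
  choose s hs hs' using h
  obtain ⟨e, he⟩ := Finite.exists_max fun e => w.toFun e (s e)
  exact ⟨⟨e, s e, hs e⟩, fun e' t ht => (hs' e' t ht).trans (he e')⟩

lemma H1.normSq_nonneg (w : G.H1) : 0 ≤ w.normSq :=
  Finset.sum_nonneg fun e _ =>
    intervalIntegral.integral_nonneg (G.len_pos e).le fun _ _ => sq_nonneg _

lemma H1.energy_nonneg (w : G.H1) : 0 ≤ w.energy :=
  Finset.sum_nonneg fun e _ =>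
    intervalIntegral.integral_nonneg (G.len_pos e).le fun _ _ => sq_nonneg _

/-- The moments of an `H¹` function. -/
lemma H1.integral_quadratic (w : G.H1) (r s t : ℝ) :
    ∫ z, (r * w.toFun z.1 z.2 ^ 2 + s * w.toFun z.1 z.2 + t) ∂G.vol =
      r * w.normSq + s * w.integral + t * G.totalLength := by
  rw [integral_vol (w.integrable_comp (φ := fun y => r * y ^ 2 + s * y + t) (by fun_prop)),
    normSq, integral, totalLength, Finset.mul_sum, Finset.mul_sum, Finset.mul_sum,
    ← Finset.sum_add_distrib, ← Finset.sum_add_distrib]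
  refine Finset.sum_congr rfl fun e _ => ?_
  have h1 : IntervalIntegrable (w.toFun e) volume 0 (G.len e) :=
    (w.continuousOn_uIcc e).intervalIntegrable
  have h2 : IntervalIntegrable (fun x => w.toFun e x ^ 2) volume 0 (G.len e) :=
    ((w.continuousOn_uIcc e).pow 2).intervalIntegrable
  rw [intervalIntegral.integral_add ((h2.const_mul r).add (h1.const_mul s))
      intervalIntegrable_const, intervalIntegral.integral_add (h2.const_mul r) (h1.const_mul s),
      intervalIntegral.integral_const_mul, intervalIntegral.integral_const_mul,
      intervalIntegral.integral_const, sub_zero, smul_eq_mul, mul_comm t]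

/-- The lower bound for the Rayleigh quotient in terms of the diameter and the total length. -/
lemma H1.sq_mul_normSq_le {k : ℝ} (hk : 0 < k)
    (hkD : k * G.diam + 2 * Real.arctan (k * ((G.totalLength - G.diam) / 2)) = Real.pi)
    (w : G.H1) (hw : w.integral = 0) : k ^ 2 * w.normSq ≤ w.energy := by
  obtain ⟨x, hx⟩ := w.exists_min
  obtain ⟨y, hy⟩ := w.exists_max
  set a := w.toFun x.edge x.pos with ha
  set b := w.toFun y.edge y.pos with hb
  -- If the extrema coincide, `w` is constant, hence zero almost everywhere by its mean.
  obtain hab | hab := (show a ≤ b from hx _ _ y.pos_mem).eq_or_lt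
  · have hae : ∀ᵐ z ∂G.vol, w.toFun z.1 z.2 = a :=
      ae_vol fun e t ht => le_antisymm (hab ▸ hy e t ht) (hx e t ht)
    have hz : ∫ z, (w.toFun z.1 z.2 - a) ^ 2 ∂G.vol = 0 := by
      refine integral_eq_zero_of_ae ?_
      filter_upwards [hae] with z hz
      simp [hz]
    have h1 := w.integral_quadratic 1 (-(2 * a)) (a ^ 2)
    rw [show (fun z : G.E × ℝ => 1 * w.toFun z.1 z.2 ^ 2 + -(2 * a) * w.toFun z.1 z.2 + a ^ 2) =
      fun z => (w.toFun z.1 z.2 - a) ^ 2 by ext z; ring, hz, hw] at h1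
    have h2 : 0 ≤ a ^ 2 * G.totalLength :=
      mul_nonneg (sq_nonneg a) (diam_pos.le.trans diam_le_totalLength)
    have h3 : w.normSq = 0 := le_antisymm (by linarith) w.normSq_nonneg
    rw [h3, mul_zero]
    exact w.energy_nonneg
  · obtain ⟨γ, σ, hγ, hγy⟩ := exists_isGeodesic x y
    have hp := dist_nonneg x y
    set p := G.dist x y with hpdef
    have hsq : ∀ s, (σ s * w.der (γ s).1 (γ s).2) ^ 2 = w.der (γ s).1 (γ s).2 ^ 2 := by
      intro s
      rw [mul_pow, ← sq_abs, hγ.abs_sign, one_pow, one_mul]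
    have h0 : w.toFun (γ 0).1 (γ 0).2 = a := by
      have := hγ.eval w 0 ⟨le_rfl, hp⟩
      rwa [intervalIntegral.integral_same, add_zero] at this
    -- Applied to `t - a`, `b - t` and `(b - t) * (t - a)`, whose integrals over the graph are known
    -- from the moments of `w`.
    have hle : ∀ φ : ℝ → ℝ, Continuous φ → (∀ t, a ≤ t → t ≤ b → 0 ≤ φ t) →
        ∫ s in 0..p, φ (w.toFun (γ s).1 (γ s).2) ≤ ∫ z, φ (w.toFun z.1 z.2) ∂G.vol :=
      fun φ hφ hφ0 => hγ.integral_le hp (w.integrable_comp hφ)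
        (ae_vol fun e t ht => hφ0 _ (hx e t ht) (hy e t ht))
    refine rayleigh_bound (D := G.diam) (L := G.totalLength) (p := p) (a := a) (b := b)
      (f := fun s => w.toFun (γ s).1 (γ s).2) (g := fun s => σ s * w.der (γ s).1 (γ s).2)
      hp (dist_le_diam x y) diam_le_totalLength hk hkD (hγ.intervalIntegrable_der hp w) ?_ ?_
      h0 ?_ hab ?_ ?_ ?_ ?_
    · simp only [hsq]
      exact hγ.intervalIntegrable hp w.integrable_der_sq
    · intro s hs
      simp only [h0]
      exact hγ.eval w s hs
    · simp only [hγy, hb]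
    · simp only [hsq]
      refine (hγ.integral_le hp w.integrable_der_sq (.of_forall fun z => sq_nonneg _)).trans_eq ?_
      rw [integral_vol w.integrable_der_sq]
      rfl
    · refine (hle (fun t => t - a) (by fun_prop) fun t ht _ => sub_nonneg.2 ht).trans_eq ?_
      have := w.integral_quadratic 0 1 (-a)
      rw [show (fun z : G.E × ℝ => w.toFun z.1 z.2 - a) =
        fun z => 0 * w.toFun z.1 z.2 ^ 2 + 1 * w.toFun z.1 z.2 + -a by ext z; ring, this, hw]
      ring
    · refine (hle (fun t => b - t) (by fun_prop) fun t _ ht => sub_nonneg.2 ht).trans_eq ?_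
      have := w.integral_quadratic 0 (-1) b
      rw [show (fun z : G.E × ℝ => b - w.toFun z.1 z.2) =
        fun z => 0 * w.toFun z.1 z.2 ^ 2 + -1 * w.toFun z.1 z.2 + b by ext z; ring, this, hw]
      ring
    · refine (hle (fun t => (b - t) * (t - a)) (by fun_prop) fun t ht ht' =>
        mul_nonneg (sub_nonneg.2 ht') (sub_nonneg.2 ht)).trans_eq ?_
      have := w.integral_quadratic (-1) (a + b) (-(a * b))
      rw [show (fun z : G.E × ℝ => (b - w.toFun z.1 z.2) * (w.toFun z.1 z.2 - a)) =
        fun z => -1 * w.toFun z.1 z.2 ^ 2 + (a + b) * w.toFun z.1 z.2 + -(a * b) by ext z; ring,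
        this, hw]
      ring

/-- An `H¹` function from a differentiable function on every edge. -/
noncomputable def H1.ofHasDerivAt (f f' : G.E → ℝ → ℝ) (hf : ∀ e x, HasDerivAt (f e) (f' e x) x)
    (hf' : ∀ e, Continuous (f' e))
    (hv : ∃ val : G.V → ℝ, ∀ e, f e 0 = val (G.src e) ∧ f e (G.len e) = val (G.tgt e)) : G.H1 where
  toFun := f
  der := f'
  der_memLp e := by
    refine (memLp_two_iff_integrable_sq (hf' e).aestronglyMeasurable).2 ?_
    exact ((hf' e).pow 2).continuousOn.integrableOn_Icc
  eq_integral e x _ := by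
    rw [intervalIntegral.integral_eq_sub_of_hasDerivAt (fun t _ => hf e t)
      ((hf' e).intervalIntegrable _ _)]
    ring
  continuous_vertex := hv

/-- A full period of a sine on one edge. Without a competitor `lambda1` would be the infimum of the
empty set, which is 0 in ℝ, and no positive lower bound could hold. -/
lemma exists_mean_zero : ∃ w : G.H1, w.integral = 0 ∧ w.normSq ≠ 0 := by
  classical
  let e₀ := Classical.arbitrary G.E
  set c := 2 * Real.pi / G.len e₀ with hc
  have hl := G.len_pos e₀
  have hcl : c * G.len e₀ = 2 * Real.pi := div_mul_cancel₀ _ hl.ne'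
  have hc0 : c ≠ 0 := (div_pos (by positivity) hl).ne'
  have hd : ∀ x : ℝ, HasDerivAt (fun x => Real.sin (c * x)) (c * Real.cos (c * x)) x := by
    intro x
    have := (Real.hasDerivAt_sin (c * x)).comp x ((hasDerivAt_id x).const_mul c)
    convert! this using 1
    ring
  let w : G.H1 := H1.ofHasDerivAt (fun e x => if e = e₀ then Real.sin (c * x) else 0)
    (fun e x => if e = e₀ then c * Real.cos (c * x) else 0)
    (fun e x => by
      by_cases h : e = e₀
      · simpa only [h, if_true] using hd x
      · simpa only [h, if_false] using hasDerivAt_const x (0 : ℝ))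
    (fun e => by
      by_cases h : e = e₀
      · simp only [h, if_true]
        fun_prop
      · simp only [h, if_false]
        fun_prop)
    ⟨fun _ => 0, fun e => by
      by_cases h : e = e₀
      · subst h
        simp only [if_true, hcl]
        simp
      · simp [h]⟩
  have hw : ∀ e x, w.toFun e x = if e = e₀ then Real.sin (c * x) else 0 := fun _ _ => rfl
  refine ⟨w, ?_, ?_⟩
  · unfold H1.integral
    refine Finset.sum_eq_zero fun e _ => ?_
    by_cases h : e = e₀
    · simp only [hw, h, if_true]
      rw [intervalIntegral.integral_comp_mul_left _ hc0, hcl, integral_sin]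
      simp
    · simp [hw, h]
  · have : 0 < w.normSq := by
      refine Finset.sum_pos' (fun e _ =>
        intervalIntegral.integral_nonneg (G.len_pos e).le fun _ _ => sq_nonneg _)
        ⟨e₀, Finset.mem_univ _, ?_⟩
      simp only [hw, if_true]
      rw [intervalIntegral.integral_comp_mul_left (fun x => Real.sin x ^ 2) hc0, hcl,
        integral_sin_sq]
      simp only [mul_zero, Real.sin_zero, Real.sin_two_pi, smul_eq_mul]
      have hc1 : 0 < c := div_pos (by positivity) hl
      have := Real.pi_pos
      rw [zero_mul, zero_mul, sub_self, zero_add, sub_zero]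
      positivity
    exact this.ne'

/-- A lower bound for the spectral gap in terms of the diameter and the total length. -/
theorem sq_le_lambda1 {k : ℝ} (hk : 0 < k)
    (hkD : k * G.diam + 2 * Real.arctan (k * ((G.totalLength - G.diam) / 2)) = Real.pi) :
    k ^ 2 ≤ G.lambda1 := by
  obtain ⟨w, hw, hw'⟩ := exists_mean_zero (G := G)
  refine le_csInf ⟨_, w, hw, hw', rfl⟩ ?_
  rintro _ ⟨w, hw, hw', rfl⟩
  rw [le_div_iff₀ (lt_of_le_of_ne w.normSq_nonneg hw'.symm)]
  exact w.sq_mul_normSq_le hk hkD hw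

lemma lambda1_le {R : ℝ} (w : G.H1) (hw : w.integral = 0) (hpos : 0 < w.normSq)
    (hR : w.energy ≤ R * w.normSq) : G.lambda1 ≤ R := by
  refine le_trans (csInf_le ⟨0, ?_⟩ ⟨w, hw, hpos.ne', rfl⟩) ((div_le_iff₀ hpos).2 hR)
  rintro _ ⟨w, -, -, rfl⟩
  exact div_nonneg w.energy_nonneg w.normSq_nonneg

/-! ### Star dumbbells: size and test functions -/

section Dumbbell

variable {m : ℕ} {h l : ℝ} (hh : 0 < h) (hl : 0 < l)

lemma starDumbbell_sum (F : (starDumbbell m h l hh hl).E → ℝ) :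
    ∑ e, F e = F none + (∑ i, F (some (true, i)) + ∑ i, F (some (false, i))) := by
  refine (Fintype.sum_option (α := Bool × Fin m) F).trans ?_
  rw [Fintype.sum_prod_type, Fintype.sum_bool]

lemma starDumbbell_totalLength :
    (starDumbbell m h l hh hl).totalLength = h + 2 * (m * l) := by
  unfold totalLength
  rw [starDumbbell_sum]
  change h + (∑ _i : Fin m, l + ∑ _i : Fin m, l) = _
  simp
  ring

/-- Every point is within `l` of the handle, and two points of the handle are within `h` of each
other. -/
lemma starDumbbell_diam_le : (starDumbbell m h l hh hl).diam ≤ h + 2 * l := by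
  set T := starDumbbell m h l hh hl with hT
  let e₀ : T.E := (none : Option (Bool × Fin m))
  have h0 : (0 : ℝ) ∈ Set.Icc 0 h := ⟨le_rfl, hh.le⟩
  have h1 : h ∈ Set.Icc 0 h := ⟨hh.le, le_rfl⟩
  have key : ∀ p : T.Point, ∃ t ∈ Set.Icc 0 h, T.dist p (T.point e₀ t) ≤ l := by
    intro p
    have hbase : ∀ t ∈ Set.Icc 0 h, Glued (T.point p.edge 0) (T.point e₀ t) → p.pos ≤ l →
        ∃ t ∈ Set.Icc 0 h, T.dist p (T.point e₀ t) ≤ l := by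
      intro t ht hg hpl
      refine ⟨t, ht, (dist_triangle p (T.point p.edge 0) _).trans ?_⟩
      have := dist_point_le p.pos_mem (zero_mem p.edge)
      rw [point_edge_pos, sub_zero, abs_of_nonneg p.pos_mem.1] at this
      rw [hg.dist_eq_zero, add_zero]
      exact this.trans hpl
    obtain ⟨e, t, ht⟩ := p
    match e, ht with
    | none, ht =>
      refine ⟨t, ht, ?_⟩
      have := dist_le_of_edge_eq (show (⟨e₀, t, ht⟩ : T.Point).edge = (T.point e₀ t).edge from rfl)
      rw [point_pos (e := e₀) ht, sub_self, abs_zero] at this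
      exact this.trans hl.le
    | some (false, i), ht =>
      exact hbase 0 h0 (.inr ⟨_, isAt_src _, isAt_src e₀⟩) ht.2
    | some (true, i), ht =>
      exact hbase h h1 (.inr ⟨_, isAt_src _, isAt_tgt e₀⟩) ht.2
  refine csSup_le nonempty_dist ?_
  rintro _ ⟨p, q, rfl⟩
  obtain ⟨s, hs, hps⟩ := key p
  obtain ⟨t, ht, hqt⟩ := key q
  have h2 := dist_triangle p (T.point e₀ s) q
  have h3 := dist_triangle (T.point e₀ s) (T.point e₀ t) q
  have h4 : T.dist (T.point e₀ s) (T.point e₀ t) ≤ |s - t| := dist_point_le hs ht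
  have h5 : |s - t| ≤ h := abs_sub_le_iff.2 ⟨by linarith [hs.2, ht.1], by linarith [ht.2, hs.1]⟩
  rw [dist_comm q] at hqt
  linarith

/-- Integrating the derivative of `k sin cos` reduces the comparison of energy and norm on the
handle to boundary terms. -/
lemma integral_cos_sq_eq (k c a b : ℝ) :
    ∫ x in a..b, (k * Real.cos (k * x + c)) ^ 2 =
      k ^ 2 * (∫ x in a..b, Real.sin (k * x + c) ^ 2) +
        k * (Real.sin (k * b + c) * Real.cos (k * b + c) -
          Real.sin (k * a + c) * Real.cos (k * a + c)) := by
  have hd : ∀ x : ℝ, HasDerivAt (fun x => k * (Real.sin (k * x + c) * Real.cos (k * x + c)))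
      ((k * Real.cos (k * x + c)) ^ 2 - k ^ 2 * Real.sin (k * x + c) ^ 2) x := by
    intro x
    have h1 : HasDerivAt (fun x : ℝ => k * x + c) k x := by
      simpa using ((hasDerivAt_id x).const_mul k).add_const c
    convert! (h1.sin.mul h1.cos).const_mul k using 1
    ring
  have := intervalIntegral.integral_eq_sub_of_hasDerivAt (a := a) (b := b) (fun x _ => hd x)
    (Continuous.intervalIntegrable (by fun_prop) _ _)
  rw [intervalIntegral.integral_sub (Continuous.intervalIntegrable (by fun_prop) _ _)
    (Continuous.intervalIntegrable (by fun_prop) _ _), intervalIntegral.integral_const_mul] at this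
  linarith

/-- Test functions on a star dumbbell: a sine on the handle and `± φ` on the pendant edges. -/
lemma starDumbbell_lambda1_le {k : ℝ} (hk : 0 < k) (hkh : k * h < 2 * Real.pi) {φ φ' : ℝ → ℝ}
    (hφ : ∀ x, HasDerivAt φ (φ' x) x) (hφ' : Continuous φ') (hφ0 : φ 0 = Real.sin (k * h / 2))
    (hle : k * (Real.sin (k * h / 2) * Real.cos (k * h / 2)) + m * ∫ x in 0..l, φ' x ^ 2 ≤
      m * (k ^ 2 * ∫ x in 0..l, φ x ^ 2)) :
    (starDumbbell m h l hh hl).lambda1 ≤ k ^ 2 := by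
  set T := starDumbbell m h l hh hl with hT
  let sg : Bool → ℝ := fun s => if s then 1 else -1
  let f : Option (Bool × Fin m) → ℝ → ℝ := fun e => match e with
    | none => fun x => Real.sin (k * x + -(k * h / 2))
    | some (s, _) => fun x => sg s * φ x
  let f' : Option (Bool × Fin m) → ℝ → ℝ := fun e => match e with
    | none => fun x => k * Real.cos (k * x + -(k * h / 2))
    | some (s, _) => fun x => sg s * φ' x
  let val : Bool × Option (Fin m) → ℝ := fun a => match a with
    | (s, none) => sg s * φ 0
    | (s, some _) => sg s * φ l
  have hend : k * h + -(k * h / 2) = k * h / 2 := by ring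
  have hsg : ∀ s, sg s ^ 2 = 1 := by rintro (_ | _) <;> simp [sg]
  let w : T.H1 := H1.ofHasDerivAt (G := T) f f'
    (fun e x => by
      match e with
      | none =>
        have h1 : HasDerivAt (fun x : ℝ => k * x + -(k * h / 2)) k x := by
          simpa using ((hasDerivAt_id x).const_mul k).add_const (-(k * h / 2))
        convert! h1.sin using 1
        exact mul_comm _ _
      | some (s, i) => exact (hφ x).const_mul (sg s))
    (fun e => by
      match e with
      | none => change Continuous fun x => k * Real.cos (k * x + -(k * h / 2)); fun_prop
      | some (s, i) => exact continuous_const.mul hφ')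
    ⟨val, fun e => by
      match e with
      | none =>
        constructor
        · change Real.sin (k * 0 + -(k * h / 2)) = -1 * φ 0
          rw [mul_zero, zero_add, Real.sin_neg, hφ0, neg_one_mul]
        · change Real.sin (k * h + -(k * h / 2)) = 1 * φ 0
          rw [hend, hφ0, one_mul]
      | some (s, i) => exact ⟨rfl, rfl⟩⟩
  have hint : w.integral = 0 := by
    refine (starDumbbell_sum hh hl _).trans ?_
    change (∫ x in 0..h, Real.sin (k * x + -(k * h / 2))) +
      ((∑ _i : Fin m, ∫ x in 0..l, 1 * φ x) + ∑ _i : Fin m, ∫ x in 0..l, -1 * φ x) = 0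
    rw [intervalIntegral.integral_comp_mul_add _ hk.ne', hend, mul_zero, zero_add, integral_sin,
      Real.cos_neg]
    simp
  have hnorm : w.normSq = (∫ x in 0..h, Real.sin (k * x + -(k * h / 2)) ^ 2) +
      2 * (m * ∫ x in 0..l, φ x ^ 2) := by
    refine (starDumbbell_sum hh hl _).trans ?_
    change (∫ x in 0..h, Real.sin (k * x + -(k * h / 2)) ^ 2) +
      ((∑ _i : Fin m, ∫ x in 0..l, (sg true * φ x) ^ 2) +
        ∑ _i : Fin m, ∫ x in 0..l, (sg false * φ x) ^ 2) = _
    simp only [mul_pow, hsg, one_mul, Finset.sum_const, Finset.card_univ, Fintype.card_fin,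
      nsmul_eq_mul]
    ring
  have henergy : w.energy = (∫ x in 0..h, (k * Real.cos (k * x + -(k * h / 2))) ^ 2) +
      2 * (m * ∫ x in 0..l, φ' x ^ 2) := by
    refine (starDumbbell_sum hh hl _).trans ?_
    change (∫ x in 0..h, (k * Real.cos (k * x + -(k * h / 2))) ^ 2) +
      ((∑ _i : Fin m, ∫ x in 0..l, (sg true * φ' x) ^ 2) +
        ∑ _i : Fin m, ∫ x in 0..l, (sg false * φ' x) ^ 2) = _
    simp only [mul_pow (sg _), hsg, one_mul, Finset.sum_const, Finset.card_univ, Fintype.card_fin,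
      nsmul_eq_mul]
    ring
  have hkh0 : 0 < k * h := mul_pos hk hh
  have hpos : 0 < ∫ x in 0..h, Real.sin (k * x + -(k * h / 2)) ^ 2 := by
    refine intervalIntegral.integral_pos hh (Continuous.continuousOn (by fun_prop))
      (fun _ _ => sq_nonneg _) ⟨h, ⟨hh.le, le_rfl⟩, ?_⟩
    rw [hend]
    exact pow_pos (Real.sin_pos_of_pos_of_lt_pi (by linarith) (by linarith)) 2
  have hφpos : 0 ≤ ∫ x in 0..l, φ x ^ 2 :=
    intervalIntegral.integral_nonneg hl.le fun _ _ => sq_nonneg _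
  refine lambda1_le w hint ?_ ?_
  · rw [hnorm]
    positivity
  -- The integral of the squared sine cancels, and by symmetry what remains is twice `hle`.
  · rw [hnorm, henergy, integral_cos_sq_eq, hend, mul_zero, zero_add, Real.sin_neg, Real.cos_neg]
    linarith

/-- The spectral gap of a star dumbbell is at most that of its handle with point masses. -/
lemma starDumbbell_lambda1_le_of_arctan {k : ℝ} (hk : 0 < k)
    (hkm : k * h + 2 * Real.arctan (k * (m * l)) = Real.pi) :
    (starDumbbell m h l hh hl).lambda1 ≤ k ^ 2 := by
  have harc : 0 ≤ Real.arctan (k * (m * l)) := Real.arctan_nonneg.2 (by positivity)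
  have hhalf : k * h / 2 = Real.pi / 2 - Real.arctan (k * (m * l)) := by linarith
  -- The balance at a handle end with a mass `m * l`: constant pendant edges act as a point mass.
  have htan : Real.cos (k * h / 2) = k * (m * l) * Real.sin (k * h / 2) := by
    rw [hhalf, Real.cos_pi_div_two_sub, Real.sin_pi_div_two_sub]
    conv_rhs => rw [← Real.tan_arctan (k * (m * l))]
    rw [Real.arctan_tan (Real.neg_pi_div_two_lt_arctan _) (Real.arctan_lt_pi_div_two _),
      Real.tan_mul_cos (Real.cos_arctan_pos _).ne']
  refine starDumbbell_lambda1_le hh hl hk (by linarith [Real.pi_pos])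
    (fun x => hasDerivAt_const x (Real.sin (k * h / 2))) continuous_const rfl (le_of_eq ?_)
  rw [htan]
  simp
  ring

/-- For `m = 1` the graph is an interval of length `π / k`; continuing the sine from the handle
gives its Neumann eigenfunction. -/
lemma starDumbbell_one_lambda1_le {k : ℝ} (hk : 0 < k) (hkm : k * (h + 2 * l) = Real.pi) :
    (starDumbbell 1 h l hh hl).lambda1 ≤ k ^ 2 := by
  have hkl : 0 < k * l := mul_pos hk hl
  have hd : ∀ x : ℝ, HasDerivAt (fun x => Real.sin (k * x + k * h / 2))
      (k * Real.cos (k * x + k * h / 2)) x := by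
    intro x
    have h1 : HasDerivAt (fun x : ℝ => k * x + k * h / 2) k x := by
      simpa using ((hasDerivAt_id x).const_mul k).add_const (k * h / 2)
    convert! h1.sin using 1
    exact mul_comm _ _
  refine starDumbbell_lambda1_le hh hl hk (by linarith [Real.pi_pos]) hd (by fun_prop)
    (by simp) (le_of_eq ?_)
  rw [integral_cos_sq_eq, show k * l + k * h / 2 = Real.pi / 2 by linarith, Real.cos_pi_div_two,
    mul_zero, mul_zero, zero_add, Nat.cast_one]
  ring

end Dumbbell

end MetricGraph

/-! ### Choice of the dumbbell -/

theorem mainTheorem9 (G : MetricGraph.{u, v}) :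
    ∃ (m : ℕ) (h l : ℝ) (hh : 0 < h) (hl : 0 < l),
      (2 ≤ m ∨ (m = 1 ∧ G.IsPath)) ∧
      (MetricGraph.starDumbbell m h l hh hl).totalLength ≤ G.totalLength ∧
      (MetricGraph.starDumbbell m h l hh hl).diam ≤ min (2 * G.diam) G.totalLength ∧
      (MetricGraph.starDumbbell m h l hh hl).lambda1 ≤ G.lambda1 := by
  have hD : 0 < G.diam := MetricGraph.diam_pos
  have hDL : G.diam ≤ G.totalLength := MetricGraph.diam_le_totalLength
  obtain ⟨k, hk, hkD⟩ := exists_frequency hD hDL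
  have hgap := MetricGraph.sq_le_lambda1 hk hkD
  obtain heq | hlt := hDL.eq_or_lt
  · have h3 : 0 < G.totalLength / 3 := by linarith
    -- Any positive lengths with `h + 2 * l = L` would do.
    refine ⟨1, _, _, h3, h3, .inr ⟨rfl, MetricGraph.isPath_of_diam_eq heq⟩, ?_, ?_, ?_⟩
    · rw [MetricGraph.starDumbbell_totalLength]
      push_cast
      linarith
    · refine (MetricGraph.starDumbbell_diam_le h3 h3).trans (le_min ?_ ?_) <;> linarith
    · refine (MetricGraph.starDumbbell_one_lambda1_le h3 h3 hk ?_).trans hgap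
      rw [heq, sub_self, zero_div, mul_zero, Real.arctan_zero, mul_zero, add_zero] at hkD
      rw [← hkD]
      ring
  -- `δ` is the room left for `2 * l` in the diameter bound. Since `2 * l = (L - D) / (n + 2)`, any
  -- `n > (L - D) / δ` suffices; the added 2 secures `2 ≤ m`.
  · set δ := min (2 * G.diam) G.totalLength - G.diam with hδ
    have hδ0 : 0 < δ := sub_pos.2 (lt_min (by linarith) hlt)
    obtain ⟨n, hn⟩ := exists_nat_gt ((G.totalLength - G.diam) / δ)
    rw [div_lt_iff₀ hδ0] at hn
    have hm : (0 : ℝ) < (n + 2 : ℕ) := by positivity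
    set l := (G.totalLength - G.diam) / 2 / (n + 2 : ℕ) with hl
    have hl0 : 0 < l := div_pos (by linarith) hm
    have hml : (n + 2 : ℕ) * l = (G.totalLength - G.diam) / 2 := mul_div_cancel₀ _ hm.ne'
    refine ⟨n + 2, G.diam, l, hD, hl0, .inl (by omega), ?_, ?_, ?_⟩
    · rw [MetricGraph.starDumbbell_totalLength, hml]
      linarith
    · refine (MetricGraph.starDumbbell_diam_le hD hl0).trans ?_
      have h2 : 2 * l ≤ δ := by
        refine le_of_mul_le_mul_left ?_ hm
        push_cast at hml ⊢
        nlinarith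
      linarith
    · exact (MetricGraph.starDumbbell_lambda1_le_of_arctan hD hl0 hk (by rwa [hml])).trans hgap
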